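/- **Proposition 1 (Generating a summary graph by operating on at most two nodes).** *Definitions.* All graphs are finite. A *summary graph* $G$ has a node set $N$ that is the disjoint union of two sets $u,v$, ordered as $(u,v)$. Within $u$ it has arrows $i\leftarrow k$ and dashed lines $i\,\text{- -}\,k$; within $v$ it has full lines $i — k$; between $u$ and $v$ it has only arrows pointing from $v$ to $u$; and it has no directed cycle. A pair may be coupled by both an arrow and a dashed line. A node $k$ is an *ancestor* of $i$ (and $i$ a *descendant* of $k$) if there is a directed path with at least one arrow from $k$ to $i$. The inner node of a two-edge path is a *collision node* in $\circ\to\circ\leftarrow\circ$, $\circ\to\circ\,\text{- -}\,\circ$ and $\circ\,\text{- -}\,\circ\,\text{- -}\,\circ$ and a *transmitting node* otherwise. For disjoint $\alpha,\beta,c\subseteq N$, $G$ *implies* $\alpha\perp\!\!\!\perp\beta\mid c$ if there is no path (with distinct inner nodes) between a node of $\alpha$ and a node of $\beta$ on which every inner collision node is in $c$ or has a descendant in $c$ and every other inner node is outside $c$. *Summary graph of a directed acyclic graph.* Let $D$ be a directed acyclic graph with node set $V$ and let $C,M\subseteq V$ be disjoint. Let $\mathcal A$ be its edge matrix ($\mathcal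 A_{ik}=1$ if $i=k$ or $i\leftarrow k$, and $0$ otherwise), $F$ the set of ancestors of $C$ outside $C$, $R=C\cup F$, $O=V\setminus R$, $p=O\cap M$, $q=F\cap M$, $u=O\setminus M$, $v=F\setminus M$. For a binary matrix $\mathcal F$ with unit diagonal and a node set $a$ with complement $b$, let $\mathcal F_{aa}^-$ be the reflexive–transitive closure of $\mathcal F_{aa}$ and let $$\operatorname{zer}_a\mathcal F=\operatorname{In}\begin{pmatrix}\mathcal F_{aa}^-&\mathcal F_{aa}^-\mathcal F_{ab}\\ \mathcal F_{ba}\mathcal F_{aa}^-&\mathcal F_{bb}+\mathcal F_{ba}\mathcal F_{aa}^-\mathcal F_{ab}\end{pmatrix},$$ where $\operatorname{In}$ replaces each nonzero entry by $1$. Put $\mathcal D=\operatorname{zer}_p\mathcal A$ and let $\mathcal S=\operatorname{In}[\mathcal A_{RR}^{\mathrm T}\mathcal A_{RR}]_{F,F}$ and $\mathcal T=\operatorname{zer}_q\mathcal S$. Then $G^{V\setminus[C,M]}_{\rm sum}$ is the graph with node set $(u,v)$ whose arrows within $u$ are given by $\mathcal D_{uu}$, arrows from $v$ to $u$ by $\operatorname{In}[\mathcal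 D_{uv}+\mathcal D_{uq}\mathcal T_{qv}]$, dashed lines by $\operatorname{In}[\mathcal I_{uu}+\mathcal D_{up}\mathcal D_{up}^{\mathrm T}+\mathcal D_{uq}\mathcal T_{qq}\mathcal D_{uq}^{\mathrm T}]$ and full lines by $\mathcal T_{vv}$ (off-diagonal entries). *Procedure.* Let $G$ be a summary graph with node set $N=(u,v)$ and let $s\ne t$ be nodes of $N$, $s$ to be conditioned on and $t$ to be marginalised over; one or both may be absent. Let $d_s$ be the set of ancestors of $s$ within $u$ (empty if $s$ is absent), $v'=(v\cup d_s)\setminus\{s,t\}$ and $u'=N\setminus(\{s,t\}\cup v')$. 1. First, for all pairs $i\ne k$ of neighbors of $t$, add the edge induced by marginalising over $t$: - $i\leftarrow t\to k$ and $i\leftarrow t\,\text{- -}\,k$ each induce $i\,\text{- -}\,k$; - $i\leftarrow t — k$, $i\leftarrow t\leftarrow k$ and $i\,\text{- -}\,t — k$ each induce $i\leftarrow k$; - $i — t — k$ and $i — t\leftarrow k$ each induce $i — k$. Second, ignoring edges that involve $t$, for $a=s$ and for every ancestor $a\neq t$ of $s$ in $G$, taken one at a time in any order in the graph obtained so far,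 add for all pairs $i\ne k$ of neighbors of $a$ the induced edge: - $i\to a\leftarrow k$ induces $i — k$; - $i\to a\,\text{- -}\,k$ induces $i\to k$; - $i\,\text{- -}\,a\,\text{- -}\,k$ induces $i\,\text{- -}\,k$. 2. Change each edge within $v'$ into a full line and each edge between $u'$ and $v'$ into an arrow pointing from $v'$ to $u'$. 3. Of several edges of the same kind for a node pair keep just one, and delete $s$, $t$ and all edges involving them. *Statement.* Let $G$ be a summary graph with node set $N$. (a) For $s,t$ as above, the procedure yields one and the same graph $G'$ for every order of the ancestors of $s$, and $G'$ is the independence-preserving summary graph $G^{N\setminus[s,t]}_{\rm sum}$. That is: $G'$ is a summary graph with node set $N\setminus\{s,t\}=(u',v')$; for all disjoint $\alpha,\beta,c\subseteq N\setminus\{s,t\}$, $G'$ implies $\alpha\perp\!\!\!\perp\beta\mid c$ if and only if $G$ implies $\alpha\perp\!\!\!\perp\beta\mid c\cup\{s\}$; and whenever $G=G^{V\setminus[C,M]}_{\rm sum}$ for a directed acyclic graph $D$ with node set $V$ and disjoint $C,M\subseteq V$, then $G'=G^{V\setminus[C\cup\{s\},\,M\cup\{t\}]}_{\rm sum}$,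 and $G'$ implies $\alpha\perp\!\!\!\perp\beta\mid c$ if and only if $D$ implies $\alpha\perp\!\!\!\perp\beta\mid c\cup C\cup\{s\}$. (b) The order of the operations does not matter. The same graph $G'$ results if in step 1 one works first on $s$ and all of its ancestors (including $t$, if it is one) and then on $t$, ignoring edges that involve $s$; or if one first applies the whole procedure to $t$ only and then to $s$ only; or first to $s$ only and then to $t$ only. More generally, let $c,m\subseteq N$ be disjoint. Conditioning on the nodes of $c$ and marginalising over the nodes of $m$, one node at a time with the whole procedure, yields one and the same graph for every order of these operations, and this graph is the independence-preserving summary graph $G^{N\setminus[c,m]}_{\rm sum}$, in the sense of (a) with $c,m$ in place of $\{s\},\{t\}$; in particular, its $v$-part consists of the nodes of $v$ and the ancestors of $c$ within $u$, without the nodes in $c\cup m$. -/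

import Mathlib

/-- A graph whose nodes (a subset of `V`) are split into two ordered parts `(u, v)` and which has
three kinds of edge: `arrow i k` is the arrow `i ← k` (from `k` to `i`), `dashed i k` the dashed
line between `i` and `k`, `full i k` the full line between `i` and `k`. Edges of the same kind
between the same nodes are not counted twice. -/
@[ext]
structure MixedGraph (V : Type*) where
  u : Set V
  v : Set V
  arrow : V → V → Prop
  dashed : V → V → Prop
  full : V → V → Prop

namespace MixedGraph

variable {V : Type*}

/-- The node set `N`. -/
def nodes (G : MixedGraph V) : Set V := G.u ∪ G.v

/-- `k` is an ancestor of `i` (and `i` a descendant of `k`): there is a directed path with at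
least one arrow from `k` to `i`. -/
def IsAncestor (G : MixedGraph V) (k i : V) : Prop :=
  Relation.TransGen (fun x y => G.arrow y x) k i

/-- The ancestors of the nodes in `S`. -/
def ancestors (G : MixedGraph V) (S : Set V) : Set V := {k | ∃ s ∈ S, G.IsAncestor k s}

/-- The two nodes are coupled by an edge of some kind and direction. -/
def Coupled (G : MixedGraph V) (i k : V) : Prop :=
  G.arrow i k ∨ G.arrow k i ∨ G.dashed i k ∨ G.full i k

/-- Summary graph: within `u` a mixture of a directed acyclic graph and a covariance graph (dashed
lines), within `v` a concentration graph (full lines), between `u` and `v` only arrows pointing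
from `v` to `u`. -/
structure IsSummaryGraph (G : MixedGraph V) : Prop where
  disjoint : Disjoint G.u G.v
  arrow_mem : ∀ i k, G.arrow i k → i ∈ G.u ∧ k ∈ G.nodes
  acyclic : ∀ i, ¬ G.IsAncestor i i
  dashed_mem : ∀ i k, G.dashed i k → i ∈ G.u ∧ k ∈ G.u ∧ i ≠ k
  dashed_symm : ∀ i k, G.dashed i k → G.dashed k i
  full_mem : ∀ i k, G.full i k → i ∈ G.v ∧ k ∈ G.v ∧ i ≠ k
  full_symm : ∀ i k, G.full i k → G.full k i

/-- Directed acyclic graph: a summary graph with arrows only and with empty `v`. -/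
structure IsDAG (G : MixedGraph V) : Prop where
  isSummaryGraph : G.IsSummaryGraph
  v_empty : G.v = ∅
  no_dashed : ∀ i k, ¬ G.dashed i k
  no_full : ∀ i k, ¬ G.full i k

/-! ### Paths and the independence structure -/

/-- The four ways in which an edge can join `x` (on the left) and `y` (on the right):
`x ← y`, `x → y`, dashed, full. -/
inductive EdgeType
  | left
  | right
  | dashed
  | full

/-- `x` and `y` are joined by an edge of the given type. -/
def HasEdge (G : MixedGraph V) : EdgeType → V → V → Prop
  | .left, x, y => G.arrow x y
  | .right, x, y => G.arrow y x
  | .dashed, x, y => G.dashed x y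
  | .full, x, y => G.full x y

/-- The inner node of a two-edge path is a collision node for
`∘ → ∘ ← ∘`, `∘ → ∘ - - ∘`, `∘ - - ∘ ← ∘` and `∘ - - ∘ - - ∘`; otherwise it is transmitting. -/
def IsCollision (e₁ e₂ : EdgeType) : Prop :=
  (e₁ = .right ∨ e₁ = .dashed) ∧ (e₂ = .left ∨ e₂ = .dashed)

/-- The nodes `x 0, …, x n` and edges `e 0, …, e (n - 1)` form a path with distinct inner nodes
on which every inner collision node is in `c` or has a descendant in `c`, and every other inner
node is outside `c`. -/
structure IsActivePath (G : MixedGraph V) (c : Set V) (n : ℕ) (x : ℕ → V) (e : ℕ → EdgeType) :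
    Prop where
  pos : 0 < n
  edge : ∀ j, j < n → G.HasEdge (e j) (x j) (x (j + 1))
  inner_distinct : Set.InjOn x (Set.Ioo 0 n)
  collision : ∀ j, j + 1 < n → IsCollision (e j) (e (j + 1)) →
    x (j + 1) ∈ c ∨ ∃ d ∈ c, G.IsAncestor (x (j + 1)) d
  transmitting : ∀ j, j + 1 < n → ¬ IsCollision (e j) (e (j + 1)) → x (j + 1) ∉ c

/-- The graph implies that `α` is independent of `β` given `c`. -/
def Implies (G : MixedGraph V) (α β c : Set V) : Prop :=
  ¬ ∃ i ∈ α, ∃ k ∈ β, ∃ n x e, G.IsActivePath c n x e ∧ x 0 = i ∧ x n = k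

/-- The independence statements of `G'` are those of `G` that concern only the nodes of `G'` (the
other nodes outside `S` being marginalised over) and that are given `S`. -/
def PreservesIndependence (G : MixedGraph V) (S : Set V) (G' : MixedGraph V) : Prop :=
  ∀ α β c : Set V, α ⊆ G'.nodes → β ⊆ G'.nodes → c ⊆ G'.nodes →
    Disjoint α β → Disjoint α c → Disjoint β c →
    (G'.Implies α β c ↔ G.Implies α β (c ∪ S))

/-! ### The construction by inducing, re-typing and deleting edges -/

/-- Add the edges induced by marginalising over a common neighbor `t ∈ T`, ignoring edges that
involve nodes in `X`. -/
def margStep (X T : Set V) (G : MixedGraph V) : MixedGraph V where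
  u := G.u
  v := G.v
  -- `i ← t — k`, `i ← t ← k` and `i - - t — k` induce `i ← k`
  arrow i k := G.arrow i k ∨ (i ≠ k ∧ i ∉ X ∧ k ∉ X ∧ ∃ t ∈ T, t ∉ X ∧
    ((G.arrow i t ∧ G.full t k) ∨ (G.arrow i t ∧ G.arrow t k) ∨ (G.dashed i t ∧ G.full t k)))
  -- `i ← t → k`, `i ← t - - k` and `i - - t → k` induce `i - - k`
  dashed i k := G.dashed i k ∨ (i ≠ k ∧ i ∉ X ∧ k ∉ X ∧ ∃ t ∈ T, t ∉ X ∧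
    ((G.arrow i t ∧ G.arrow k t) ∨ (G.arrow i t ∧ G.dashed t k) ∨ (G.dashed i t ∧ G.arrow k t)))
  -- `i — t — k`, `i — t ← k` and `i → t — k` induce `i — k`
  full i k := G.full i k ∨ (i ≠ k ∧ i ∉ X ∧ k ∉ X ∧ ∃ t ∈ T, t ∉ X ∧
    ((G.full i t ∧ G.full t k) ∨ (G.full i t ∧ G.arrow t k) ∨ (G.arrow t i ∧ G.full t k)))

/-- Add the edges induced around the common neighbor `a` when `a` or one of its descendants is
conditioned on, ignoring edges that involve nodes in `X`. -/
def condStep (X : Set V) (G : MixedGraph V) (a : V) : MixedGraph V where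
  u := G.u
  v := G.v
  -- `i - - a ← k` induces `i ← k`
  arrow i k := G.arrow i k ∨ (i ≠ k ∧ i ∉ X ∧ k ∉ X ∧ a ∉ X ∧ G.dashed i a ∧ G.arrow a k)
  -- `i - - a - - k` induces `i - - k`
  dashed i k := G.dashed i k ∨ (i ≠ k ∧ i ∉ X ∧ k ∉ X ∧ a ∉ X ∧ G.dashed i a ∧ G.dashed a k)
  -- `i → a ← k` induces `i — k`
  full i k := G.full i k ∨ (i ≠ k ∧ i ∉ X ∧ k ∉ X ∧ a ∉ X ∧ G.arrow a i ∧ G.arrow a k)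

/-- Apply `condStep` successively to the nodes of a list. -/
def condSteps (X : Set V) (G : MixedGraph V) (L : List V) : MixedGraph V :=
  L.foldl (condStep X) G

/-- Change each edge within `v'` into a full line and each edge between `u'` and `v'` into an arrow
pointing from `v'` to `u'`, and delete all nodes and edges outside `u' ∪ v'`. -/
def retype (u' v' : Set V) (G : MixedGraph V) : MixedGraph V where
  u := u'
  v := v'
  arrow i k := (i ∈ u' ∧ k ∈ u' ∧ G.arrow i k) ∨ (i ∈ u' ∧ k ∈ v' ∧ G.Coupled i k)
  dashed i k := i ∈ u' ∧ k ∈ u' ∧ G.dashed i k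
  full i k := (i ∈ u' ∧ k ∈ u' ∧ G.full i k) ∨ (i ∈ v' ∧ k ∈ v' ∧ G.Coupled i k)

/-- The new set `v'`: the nodes of `v` and the ancestors within `u` of the conditioning nodes `S`,
without the nodes in `S` and in the marginalising set `T`. -/
def newV (G : MixedGraph V) (S T : Set V) : Set V :=
  (G.v ∪ (G.ancestors S ∩ G.u)) \ (S ∪ T)

/-- The new set `u'`: the remaining nodes. -/
def newU (G : MixedGraph V) (S T : Set V) : Set V :=
  G.nodes \ (S ∪ T ∪ G.newV S T)

/-- `H` is a result of the three-step procedure on `G` with conditioning nodes `S` and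
marginalising nodes `T` (each at most one): edges are induced first around the node of `T`,
then, ignoring edges that involve `T`, around the node of `S` and all of its
ancestors, taken one at a time in some order; then edges are re-typed and `S`, `T` deleted. -/
def Generates (G : MixedGraph V) (S T : Set V) (H : MixedGraph V) : Prop :=
  ∃ L : List V, (∀ a, a ∈ L ↔ a ∈ (S ∪ G.ancestors S) \ T) ∧
    H = retype (G.newU S T) (G.newV S T) (condSteps T (margStep ∅ T G) L)

/-- The same with the order within the first step reversed: first around the node of `S` and all
of its ancestors, then, ignoring edges that involve `S`, around the node of `T`. -/
def GeneratesCondFirst (G : MixedGraph V) (S T : Set V) (H : MixedGraph V) : Prop :=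
  ∃ L : List V, (∀ a, a ∈ L ↔ a ∈ S ∪ G.ancestors S) ∧
    H = retype (G.newU S T) (G.newV S T) (margStep S T (condSteps ∅ G L))

/-- An operation on a single node. -/
inductive Op (V : Type*)
  | condition (s : V)
  | marginalise (t : V)

/-- The node operated on. -/
def Op.node : Op V → V
  | .condition s => s
  | .marginalise t => t

/-- The nodes conditioned on in a list of operations. -/
def condSet (ops : List (Op V)) : Set V := {s | Op.condition s ∈ ops}

/-- The nodes marginalised over in a list of operations. -/
def margSet (ops : List (Op V)) : Set V := {t | Op.marginalise t ∈ ops}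

/-- `H` results from `G` by carrying out the single-node operations of the list one after the
other, each time with the full three-step procedure. -/
inductive GeneratesList : MixedGraph V → List (Op V) → MixedGraph V → Prop
  | nil (G : MixedGraph V) : GeneratesList G [] G
  | condition {G K H : MixedGraph V} {s : V} {ops : List (Op V)} :
      G.Generates {s} ∅ K → GeneratesList K ops H → GeneratesList G (.condition s :: ops) H
  | marginalise {G K H : MixedGraph V} {t : V} {ops : List (Op V)} :
      G.Generates ∅ {t} K → GeneratesList K ops H → GeneratesList G (.marginalise t :: ops) H

/-! ### The summary graph of a directed acyclic graph

Binary edge matrices are relations: sums of binary matrices (after the indicator function) are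
disjunctions, products are compositions. Edge matrices have ones along the diagonal. -/

/-- The block `F_aa⁻`: its ones are the pairs in `a` that are equal or connected by a path of
ones of `F` within `a`. (For binary `F` with `d` nodes in `a`, these are the nonzero entries of
the nonnegative matrix `((d + 1) I - F_aa)⁻¹`.) -/
def closure (a : Set V) (F : V → V → Prop) (i k : V) : Prop :=
  i ∈ a ∧ k ∈ a ∧ Relation.ReflTransGen (fun x y => x ∈ a ∧ y ∈ a ∧ F x y) i k

/-- Partial closure `zer_a F`, with blocks `F_aa⁻`, `F_aa⁻ F_ab`, `F_ba F_aa⁻` and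
`F_bb + F_ba F_aa⁻ F_ab`, where `b` is the complement of `a`. -/
def zer (a : Set V) (F : V → V → Prop) (i k : V) : Prop :=
  (i ∈ a ∧ k ∈ a ∧ closure a F i k) ∨
  (i ∈ a ∧ k ∉ a ∧ ∃ j, closure a F i j ∧ F j k) ∨
  (i ∉ a ∧ k ∈ a ∧ ∃ j, F i j ∧ closure a F j k) ∨
  (i ∉ a ∧ k ∉ a ∧ (F i k ∨ ∃ j l, F i j ∧ closure a F j l ∧ F l k))

/-- The edge matrix of a directed acyclic graph: ones on the diagonal and for `i ← k`. -/
def edgeMatrix (D : MixedGraph V) (i k : V) : Prop := i = k ∨ D.arrow i k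

/-- The foster nodes `F` of `C`: ancestors of `C` outside `C`. -/
def foster (D : MixedGraph V) (C : Set V) : Set V := D.ancestors C \ C

/-- The outsiders `O` of `R = C ∪ F`. -/
def outsiders (D : MixedGraph V) (C : Set V) : Set V := D.nodes \ (C ∪ D.foster C)

/-- The induced concentration edge matrix of the foster nodes: `[𝒜_RRᵀ 𝒜_RR]_FF`. -/
def fosterMatrix (D : MixedGraph V) (C : Set V) (i k : V) : Prop :=
  i ∈ D.foster C ∧ k ∈ D.foster C ∧
    ∃ j ∈ C ∪ D.foster C, D.edgeMatrix j i ∧ D.edgeMatrix j k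

/-- The summary graph that the directed acyclic graph `D` induces by conditioning on `C` and
marginalising over `M = (p, q)`, `p = O ∩ M`, `q = F ∩ M`, where `u = O \ M`, `v = F \ M`. With
`𝒟 = zer_p 𝒜`, and `𝒮_qq|vC`, `𝒫_q|v.C`, `𝒮^vv.qO` the blocks of `zer_q` of `fosterMatrix`, its
edge matrices are
* arrows: `ℋ_uu = 𝒟_uu`, `ℋ_uv = In[𝒟_uv + 𝒟_uq 𝒫_q|v.C]`;
* dashed lines: `𝒲_uu = In[ℐ_uu + 𝒟_up 𝒟_upᵀ + 𝒟_uq 𝒮_qq|vC 𝒟_uqᵀ]`;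
* full lines: `𝒮^vv.qO`. -/
def summaryGraph (D : MixedGraph V) (C M : Set V) : MixedGraph V where
  u := D.outsiders C \ M
  v := D.foster C \ M
  arrow i k :=
    (i ∈ D.outsiders C \ M ∧ k ∈ D.outsiders C \ M ∧ i ≠ k ∧
      zer (D.outsiders C ∩ M) D.edgeMatrix i k) ∨
    (i ∈ D.outsiders C \ M ∧ k ∈ D.foster C \ M ∧
      (zer (D.outsiders C ∩ M) D.edgeMatrix i k ∨
        ∃ j ∈ D.foster C ∩ M, zer (D.outsiders C ∩ M) D.edgeMatrix i j ∧
          zer (D.foster C ∩ M) (D.fosterMatrix C) j k))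
  dashed i k := i ∈ D.outsiders C \ M ∧ k ∈ D.outsiders C \ M ∧ i ≠ k ∧
    ((∃ j ∈ D.outsiders C ∩ M, zer (D.outsiders C ∩ M) D.edgeMatrix i j ∧
        zer (D.outsiders C ∩ M) D.edgeMatrix k j) ∨
      (∃ j ∈ D.foster C ∩ M, ∃ l ∈ D.foster C ∩ M,
        zer (D.outsiders C ∩ M) D.edgeMatrix i j ∧
          zer (D.foster C ∩ M) (D.fosterMatrix C) j l ∧
          zer (D.outsiders C ∩ M) D.edgeMatrix k l))
  full i k := i ∈ D.foster C \ M ∧ k ∈ D.foster C \ M ∧ i ≠ k ∧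
    zer (D.foster C ∩ M) (D.fosterMatrix C) i k

/-- `G'` is the independence-preserving summary graph obtained from the summary graph `G` by
conditioning on `S` and marginalising over `T`: a summary graph in the remaining nodes that
preserves the independence structure and that, whenever `G` is generated from a directed acyclic
graph `D` by conditioning on `C` and marginalising over `M`, is the summary graph
generated from `D` by conditioning on `C ∪ S` and marginalising over `M ∪ T`, and preserves the
independence structure of `D`. -/
structure IsSummaryGraphAfter (G : MixedGraph V) (S T : Set V) (G' : MixedGraph V) : Prop where
  isSummaryGraph : G'.IsSummaryGraph
  nodes_eq : G'.nodes = G.nodes \ (S ∪ T)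
  v_eq : G'.v = (G.v ∪ (G.ancestors S ∩ G.u)) \ (S ∪ T)
  preserves : G.PreservesIndependence S G'
  generated : ∀ (D : MixedGraph V) (C M : Set V), D.IsDAG → C ⊆ D.nodes → M ⊆ D.nodes →
    Disjoint C M → G = D.summaryGraph C M →
    G' = D.summaryGraph (C ∪ S) (M ∪ T) ∧ D.PreservesIndependence (C ∪ S) G'

end MixedGraph

/-! The three kinds of edge are recorded by a mark at each end: `true` at an arrowhead or dashed
end, `false` at a tail or an end of a full line. A node is a collision exactly when both marks
meeting there are `true`, so the rules for inducing edges become concatenation of marked edges.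

Let `R` consist of `v`, `S` and the ancestors of `S`. The graph `G.reduce S T` joins two remaining
nodes when a walk joins them whose inner collisions lie in `R` and whose inner transmitting nodes
lie in `T`. The marks of the walk survive at ends outside `R` and are forgotten, that is set to
`false`, at ends in `R`. This definition involves no order of operations, and everything is compared
with it.

Four facts suffice. The procedure computes `reduce`, in both versions of its first step
(`generates_iff`, `generatesCondFirst_iff`). Reductions compose by taking unions of the sets
(`reduce_reduce`), so the order of operations is irrelevant. An independence statement says that
there is no walk between the two sets with all nodes outside `c` open for transmission
(`implies_iff`); hence preserving independence is again a composition of walks. Finally, the matrix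
formulas for a directed acyclic graph describe its reduction (`summaryGraph_eq_reduce`), so the
claim on generating graphs is once more `reduce_reduce`.

What makes forgetting marks harmless is that `R` is ancestral. A walk leaving a node outside `R`
through a tail must stay outside `R` and be directed (`IsAncestral.directedWalk`). So it cannot
enter `R`, cannot end in a tail, and cannot return to its start. Collisions at a node of `T` that is
an ancestor of a conditioning node are replaced by detours down to a descendant outside `T` and
back. -/

namespace MixedGraph

variable {V : Type*}

/-! ### Marked edges and walks. -/

/-- `i` and `k` are joined by an edge with mark `a` at `i` and mark `b` at `k`, where `true` stands
for an end of the kind found at an arrowhead or a dashed line, `false` for any other end. -/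
def MarkedEdge (G : MixedGraph V) (i : V) (a : Bool) (k : V) (b : Bool) : Prop :=
  match a, b with
  | true, true => G.dashed i k
  | true, false => G.arrow i k
  | false, true => G.arrow k i
  | false, false => G.full i k

/-- A walk may pass through `x`, entering with mark `m` and leaving with mark `m'`: collision nodes
have to be in `R`, transmitting nodes in `T`. -/
def Passes (R T : Set V) (m : Bool) (x : V) (m' : Bool) : Prop :=
  (m = true ∧ m' = true ∧ x ∈ R) ∨ ((m = false ∨ m' = false) ∧ x ∈ T)

/-- There is a walk from `i` to `k` along marked edges, with mark `a` at `i` and `b` at `k`, whose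
inner collision nodes are in `R` and whose inner transmitting nodes are in `T`. -/
inductive Walk (E : V → Bool → V → Bool → Prop) (R T : Set V) (i : V) (a : Bool) :
    V → Bool → Prop
  | edge {k : V} {b : Bool} : E i a k b → Walk E R T i a k b
  | step {j k : V} {b b' c : Bool} :
      Walk E R T i a j b → Passes R T b j b' → E j b' k c → Walk E R T i a k c

theorem Passes.symm {R T : Set V} {m m' : Bool} {x : V} (h : Passes R T m x m') :
    Passes R T m' x m := by
  unfold Passes at *; tauto

theorem Passes.mono {R T R' T' : Set V} {m m' : Bool} {x : V} (h : Passes R T m x m')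
    (hR : R ⊆ R') (hT : T ⊆ T') : Passes R' T' m x m' := by
  rcases h with ⟨h, h', hx⟩ | ⟨h, hx⟩
  · exact Or.inl ⟨h, h', hR hx⟩
  · exact Or.inr ⟨h, hT hx⟩

namespace Walk

variable {E E' : V → Bool → V → Bool → Prop} {R T R' T' : Set V} {i j k : V} {a b b' c : Bool}

theorem trans (h : Walk E R T i a j b) (hp : Passes R T b j b') (h' : Walk E R T j b' k c) :
    Walk E R T i a k c := by
  induction h' with
  | edge he => exact .step h hp he
  | step _ hp' he ih => exact .step ih hp' he

theorem symm (hE : ∀ i a k b, E i a k b → E k b i a) (h : Walk E R T i a k b) :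
    Walk E R T k b i a := by
  induction h with
  | edge he => exact .edge (hE _ _ _ _ he)
  | step _ hp he ih => exact trans (.edge (hE _ _ _ _ he)) hp.symm ih

/-- Edges that are walks themselves can be replaced by these walks. -/
theorem bind (h : Walk E R T i a k b) (hE : ∀ i a k b, E i a k b → Walk E' R' T' i a k b)
    (hR : R ⊆ R') (hT : T ⊆ T') : Walk E' R' T' i a k b := by
  induction h with
  | edge he => exact hE _ _ _ _ he
  | step _ hp he ih => exact trans ih (hp.mono hR hT) (hE _ _ _ _ he)

theorem mono (h : Walk E R T i a k b) (hR : R ⊆ R') (hT : T ⊆ T') : Walk E R' T' i a k b :=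
  h.bind (fun _ _ _ _ he => .edge he) hR hT

end Walk

theorem coupled_iff (G : MixedGraph V) (i k : V) :
    G.Coupled i k ↔ ∃ a b, G.MarkedEdge i a k b := by
  simp [Coupled, MarkedEdge]; tauto

namespace IsSummaryGraph

variable {G : MixedGraph V}

theorem markedEdge_symm (hG : G.IsSummaryGraph) (i : V) (a : Bool) (k : V) (b : Bool)
    (h : G.MarkedEdge i a k b) : G.MarkedEdge k b i a := by
  cases a <;> cases b
  · exact hG.full_symm _ _ h
  · exact h
  · exact h
  · exact hG.dashed_symm _ _ h

theorem mem_nodes_right (hG : G.IsSummaryGraph) {i k : V} {a b : Bool}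
    (h : G.MarkedEdge i a k b) : k ∈ G.nodes := by
  cases a <;> cases b
  · exact Or.inr (hG.full_mem _ _ h).2.1
  · exact Or.inl (hG.arrow_mem _ _ h).1
  · exact (hG.arrow_mem _ _ h).2
  · exact Or.inl (hG.dashed_mem _ _ h).2.1

theorem mem_u_of_head (hG : G.IsSummaryGraph) {i k : V} {a : Bool}
    (h : G.MarkedEdge i a k true) : k ∈ G.u := by
  cases a
  · exact (hG.arrow_mem _ _ h).1
  · exact (hG.dashed_mem _ _ h).2.1

theorem markedEdge_ne (hG : G.IsSummaryGraph) {i k : V} {a b : Bool}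
    (h : G.MarkedEdge i a k b) : i ≠ k := by
  rintro rfl
  cases a <;> cases b
  · exact (hG.full_mem _ _ h).2.2 rfl
  · exact hG.acyclic i (.single h)
  · exact hG.acyclic i (.single h)
  · exact (hG.dashed_mem _ _ h).2.2 rfl

theorem walk_symm (hG : G.IsSummaryGraph) {R T : Set V} {i k : V} {a b : Bool}
    (h : Walk G.MarkedEdge R T i a k b) : Walk G.MarkedEdge R T k b i a :=
  h.symm hG.markedEdge_symm

theorem walk_mem_nodes (hG : G.IsSummaryGraph) {R T : Set V} {i k : V} {a b : Bool}
    (h : Walk G.MarkedEdge R T i a k b) : k ∈ G.nodes := by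
  cases h with
  | edge he => exact hG.mem_nodes_right he
  | step _ _ he => exact hG.mem_nodes_right he

theorem walk_mem_u (hG : G.IsSummaryGraph) {R T : Set V} {i k : V} {a : Bool}
    (h : Walk G.MarkedEdge R T i a k true) : k ∈ G.u := by
  cases h with
  | edge he => exact hG.mem_u_of_head he
  | step _ _ he => exact hG.mem_u_of_head he

end IsSummaryGraph

/-! ### Directed walks and ancestral sets. -/

/-- A directed walk from `i` whose inner nodes are in `T`. -/
inductive DirectedWalk (G : MixedGraph V) (T : Set V) (i : V) : V → Prop
  | edge {k : V} : G.arrow k i → DirectedWalk G T i k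
  | step {j k : V} : DirectedWalk G T i j → j ∈ T → G.arrow k j → DirectedWalk G T i k

namespace DirectedWalk

variable {G : MixedGraph V} {T : Set V} {i k : V}

theorem isAncestor (h : G.DirectedWalk T i k) : G.IsAncestor i k := by
  induction h with
  | edge he => exact .single he
  | step _ _ he ih => exact .tail ih he

theorem walk (h : G.DirectedWalk T i k) (R : Set V) :
    Walk G.MarkedEdge R T i false k true := by
  induction h with
  | edge he => exact .edge he
  | step _ hj he ih => exact .step ih (Or.inr ⟨.inr rfl, hj⟩) he

end DirectedWalk

/-- A set of nodes that contains `v` and all ancestors of its elements. -/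
structure IsAncestral (G : MixedGraph V) (R : Set V) : Prop where
  v_subset : G.v ⊆ R
  parent_mem : ∀ i k, G.arrow i k → i ∈ R → k ∈ R

theorem IsAncestral.ancestor_mem {G : MixedGraph V} {R : Set V} (hR : G.IsAncestral R) {i k : V}
    (h : G.IsAncestor k i) (hi : i ∈ R) : k ∈ R := by
  induction h with
  | single he => exact hR.parent_mem _ _ he hi
  | tail _ he ih => exact ih (hR.parent_mem _ _ he hi)

/-- A walk that leaves a node outside the ancestral set `R` through a tail is directed. -/
theorem IsAncestral.directedWalk {G : MixedGraph V} (hG : G.IsSummaryGraph) {R T : Set V}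
    (hR : G.IsAncestral R) {i k : V} {b : Bool} (h : Walk G.MarkedEdge R T i false k b)
    (hi : i ∉ R) : b = true ∧ G.DirectedWalk T i k := by
  induction h with
  | @edge k b he =>
    cases b
    · exact absurd (hR.v_subset (hG.full_mem _ _ he).1) hi
    · exact ⟨rfl, .edge he⟩
  | @step j k b b' c hw hp he ih =>
    obtain ⟨rfl, hd⟩ := ih
    -- As `j` is outside `R` and was entered through a head, it is no open collision; it must be
    -- left through a tail, and a full line would put it in `v ⊆ R`.
    have hj : j ∉ R := fun hj => hi (hR.ancestor_mem hd.isAncestor hj)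
    rcases hp with ⟨-, -, hj'⟩ | ⟨hb, hjT⟩
    · exact absurd hj' hj
    · obtain rfl : b' = false := by simpa using hb
      cases c
      · exact absurd (hR.v_subset (hG.full_mem _ _ he).1) hj
      · exact ⟨rfl, .step hd hjT he⟩

/-! ### The reduced graph. -/

/-- The nodes at which collisions are opened by conditioning on `S`, and the nodes of `v`. -/
def condClosure (G : MixedGraph V) (S : Set V) : Set V := G.v ∪ S ∪ G.ancestors S

theorem isAncestral_condClosure {G : MixedGraph V} (hG : G.IsSummaryGraph) (S : Set V) :
    G.IsAncestral (G.condClosure S) where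
  v_subset _ h := Or.inl (Or.inl h)
  parent_mem i k h hi := by
    rcases hi with (hi | hi) | ⟨s, hs, hi⟩
    · exact absurd hi (hG.disjoint.notMem_of_mem_left (hG.arrow_mem _ _ h).1)
    · exact Or.inr ⟨i, hi, .single h⟩
    · exact Or.inr ⟨s, hs, .head h hi⟩

theorem IsSummaryGraph.ancestors_subset {G : MixedGraph V} (hG : G.IsSummaryGraph) (S : Set V) :
    G.ancestors S ⊆ G.nodes := by
  rintro k ⟨s, -, h⟩
  induction h using Relation.TransGen.head_induction_on with
  | single he => exact (hG.arrow_mem _ _ he).2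
  | head he _ _ => exact (hG.arrow_mem _ _ he).2

/-- Conditioning on `S` and marginalising over `T`: the edges are given by the walks whose inner
collision nodes are in `G.condClosure S` and whose inner transmitting nodes are in `T`; the kind of
their ends is kept outside `G.condClosure S`. -/
def reduce (G : MixedGraph V) (S T : Set V) : MixedGraph V where
  u := G.nodes \ (S ∪ T ∪ G.condClosure S)
  v := G.condClosure S \ (S ∪ T)
  arrow i k := i ≠ k ∧ i ∈ G.nodes \ (S ∪ T ∪ G.condClosure S) ∧
    ((k ∈ G.nodes \ (S ∪ T ∪ G.condClosure S) ∧
        Walk G.MarkedEdge (G.condClosure S) T i true k false) ∨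
      (k ∈ G.condClosure S \ (S ∪ T) ∧
        ∃ a b, Walk G.MarkedEdge (G.condClosure S) T i a k b))
  dashed i k := i ≠ k ∧ i ∈ G.nodes \ (S ∪ T ∪ G.condClosure S) ∧
    k ∈ G.nodes \ (S ∪ T ∪ G.condClosure S) ∧
    Walk G.MarkedEdge (G.condClosure S) T i true k true
  full i k := i ≠ k ∧ i ∈ G.condClosure S \ (S ∪ T) ∧ k ∈ G.condClosure S \ (S ∪ T) ∧
    ∃ a b, Walk G.MarkedEdge (G.condClosure S) T i a k b

/-- The mark `m` at `x` is seen as `m'` when the marks at nodes of `R` are forgotten. -/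
def Seen (R : Set V) (x : V) (m m' : Bool) : Prop :=
  (x ∈ R ∧ m' = false) ∨ (x ∉ R ∧ m' = m)

theorem exists_seen (R : Set V) (x : V) (m : Bool) : ∃ m', Seen R x m m' := by
  by_cases h : x ∈ R
  · exact ⟨false, Or.inl ⟨h, rfl⟩⟩
  · exact ⟨m, Or.inr ⟨h, rfl⟩⟩

theorem condClosure_subset {G : MixedGraph V} (hG : G.IsSummaryGraph) {S : Set V}
    (hS : S ⊆ G.nodes) : G.condClosure S ⊆ G.nodes :=
  Set.union_subset (Set.union_subset (fun _ h => Or.inr h) hS) (hG.ancestors_subset S)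

/-- Replaces the case distinctions in `reduce` by one uniform rule, with which all later arguments
on marks work. The cases that `reduce` leaves out, a tail at the outer end of an edge into `R` and
two tails outside `R`, cannot occur because such a walk would be directed. -/
theorem markedEdge_reduce {G : MixedGraph V} (hG : G.IsSummaryGraph) {S T : Set V}
    (hS : S ⊆ G.nodes) {i k : V} {a b : Bool} :
    (G.reduce S T).MarkedEdge i a k b ↔ i ≠ k ∧ i ∈ G.nodes \ (S ∪ T) ∧ k ∈ G.nodes \ (S ∪ T) ∧
      ∃ a₀ b₀, Walk G.MarkedEdge (G.condClosure S) T i a₀ k b₀ ∧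
        Seen (G.condClosure S) i a₀ a ∧ Seen (G.condClosure S) k b₀ b := by
  have hR := isAncestral_condClosure hG S
  have hRN := condClosure_subset hG hS
  -- With a tail at `i` the walk would be directed, making `i` an ancestor of a node of `R`.
  have key : ∀ {i k a b}, Walk G.MarkedEdge (G.condClosure S) T i a k b → i ∉ G.condClosure S →
      k ∈ G.condClosure S → a = true := by
    intro i k a b h hi hk
    cases a
    · exact absurd (hR.ancestor_mem (hR.directedWalk hG h hi).2.isAncestor hk) hi
    · rfl
  have key' : ∀ {i k a b}, Walk G.MarkedEdge (G.condClosure S) T i a k b → i ∉ G.condClosure S →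
      a = true ∨ b = true := by
    intro i k a b h hi
    cases a
    · exact Or.inr (hR.directedWalk hG h hi).1
    · exact Or.inl rfl
  have sy := @IsSummaryGraph.walk_symm V G hG (G.condClosure S) T
  constructor
  · intro h
    cases a <;> cases b <;> simp only [MarkedEdge, reduce] at h
    · obtain ⟨hne, hi, hk, a, b, h⟩ := h
      exact ⟨hne, ⟨hRN hi.1, hi.2⟩, ⟨hRN hk.1, hk.2⟩, a, b, h, Or.inl ⟨hi.1, rfl⟩,
        Or.inl ⟨hk.1, rfl⟩⟩
    · obtain ⟨hne, ⟨hk, hk'⟩, h⟩ := h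
      simp only [Set.mem_union, not_or] at hk'
      rcases h with ⟨⟨hi, hi'⟩, h⟩ | ⟨⟨hi, hi'⟩, a, b, h⟩
      · simp only [Set.mem_union, not_or] at hi'
        exact ⟨hne.symm, ⟨hi, by simp [hi']⟩, ⟨hk, by simp [hk']⟩, _, _, sy h,
          Or.inr ⟨hi'.2, rfl⟩, Or.inr ⟨hk'.2, rfl⟩⟩
      · exact ⟨hne.symm, ⟨hRN hi, hi'⟩, ⟨hk, by simp [hk']⟩, _, _, sy h,
          Or.inl ⟨hi, rfl⟩, Or.inr ⟨hk'.2, (key h hk'.2 hi).symm⟩⟩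
    · obtain ⟨hne, ⟨hk, hk'⟩, h⟩ := h
      simp only [Set.mem_union, not_or] at hk'
      rcases h with ⟨⟨hi, hi'⟩, h⟩ | ⟨⟨hi, hi'⟩, a, b, h⟩
      · simp only [Set.mem_union, not_or] at hi'
        exact ⟨hne, ⟨hk, by simp [hk']⟩, ⟨hi, by simp [hi']⟩, _, _, h,
          Or.inr ⟨hk'.2, rfl⟩, Or.inr ⟨hi'.2, rfl⟩⟩
      · exact ⟨hne, ⟨hk, by simp [hk']⟩, ⟨hRN hi, hi'⟩, _, _, h,
          Or.inr ⟨hk'.2, (key h hk'.2 hi).symm⟩, Or.inl ⟨hi, rfl⟩⟩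
    · obtain ⟨hne, ⟨hi, hi'⟩, ⟨hk, hk'⟩, h⟩ := h
      simp only [Set.mem_union, not_or] at hk' hi'
      exact ⟨hne, ⟨hi, by simp [hi']⟩, ⟨hk, by simp [hk']⟩, _, _, h,
          Or.inr ⟨hi'.2, rfl⟩, Or.inr ⟨hk'.2, rfl⟩⟩
  · rintro ⟨hne, ⟨hi, hi'⟩, ⟨hk, hk'⟩, a₀, b₀, h, ⟨ha, rfl⟩ | ⟨ha, rfl⟩, ⟨hb, rfl⟩ | ⟨hb, rfl⟩⟩
    · exact ⟨hne, ⟨ha, hi'⟩, ⟨hb, hk'⟩, _, _, h⟩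
    · obtain rfl := key (sy h) hb ha
      simp only [Set.mem_union, not_or] at hk'
      exact ⟨hne.symm, ⟨hk, by simp [hb, hk']⟩, Or.inr ⟨⟨ha, hi'⟩, _, _, sy h⟩⟩
    · obtain rfl := key h ha hb
      simp only [Set.mem_union, not_or] at hi'
      exact ⟨hne, ⟨hi, by simp [ha, hi']⟩, Or.inr ⟨⟨hb, hk'⟩, _, _, h⟩⟩
    · simp only [Set.mem_union, not_or] at hi' hk'
      have h1 := key' h ha
      cases a <;> cases b
      · simp at h1
      · exact ⟨hne.symm, ⟨hk, by simp [hb, hk']⟩, Or.inl ⟨⟨hi, by simp [ha, hi']⟩, sy h⟩⟩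
      · exact ⟨hne, ⟨hi, by simp [ha, hi']⟩, Or.inl ⟨⟨hk, by simp [hb, hk']⟩, h⟩⟩
      · exact ⟨hne, ⟨hi, by simp [ha, hi']⟩, ⟨hk, by simp [hb, hk']⟩, h⟩

/-- A graph is determined by its node sets and its marked edges. -/
theorem ext_markedEdge {G H : MixedGraph V} (hu : G.u = H.u) (hv : G.v = H.v)
    (h : ∀ i a k b, G.MarkedEdge i a k b ↔ H.MarkedEdge i a k b) : G = H := by
  apply MixedGraph.ext hu hv
  · funext i k; exact propext (h i true k false)
  · funext i k; exact propext (h i true k true)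
  · funext i k; exact propext (h i false k false)

/-- Read from its tail, a walk behind an arrow within the new `u` leaves a node outside `R` through
a tail, hence is directed. Acyclicity and ancestor relations thereby go back to `G`. -/
theorem arrow_reduce_directedWalk {G : MixedGraph V} (hG : G.IsSummaryGraph) {S T : Set V}
    {i k : V} (h : (G.reduce S T).arrow i k) :
    i ∈ (G.reduce S T).u ∧ (k ∈ (G.reduce S T).v ∨
      (k ∈ (G.reduce S T).u ∧ G.DirectedWalk T k i)) := by
  obtain ⟨-, hi, ⟨hk, h⟩ | ⟨hk, h⟩⟩ := h
  · refine ⟨hi, Or.inr ⟨hk, ?_⟩⟩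
    exact ((isAncestral_condClosure hG S).directedWalk hG (hG.walk_symm h)
      (fun h' => hk.2 (Or.inr h'))).2
  · exact ⟨hi, Or.inl hk⟩

theorem nodes_reduce {G : MixedGraph V} (hG : G.IsSummaryGraph) {S T : Set V}
    (hS : S ⊆ G.nodes) : (G.reduce S T).nodes = G.nodes \ (S ∪ T) := by
  have := condClosure_subset hG hS
  ext x
  simp only [nodes, reduce, Set.mem_union, Set.mem_sdiff, not_or]
  constructor
  · rintro (h | h)
    · tauto
    · exact ⟨this h.1, h.2⟩
  · rintro ⟨h, h'⟩
    by_cases hx : x ∈ G.condClosure S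
    · exact Or.inr ⟨hx, h'⟩
    · exact Or.inl ⟨h, h', hx⟩

theorem isSummaryGraph_reduce {G : MixedGraph V} (hG : G.IsSummaryGraph) {S T : Set V} :
    (G.reduce S T).IsSummaryGraph where
  disjoint := Set.disjoint_left.2 fun x hx hx' => hx.2 (Or.inr hx'.1)
  arrow_mem i k h := by
    obtain ⟨hi, hk | hk⟩ := arrow_reduce_directedWalk hG h
    exacts [⟨hi, Or.inr hk⟩, ⟨hi, Or.inl hk.1⟩]
  acyclic i h := by
    -- Arrows have their heads in the new `u`, so a directed path that starts there never meets the
    -- new `v` and expands to a directed path of `G`.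
    have key : ∀ x, (G.reduce S T).IsAncestor x i → x ∈ (G.reduce S T).u → G.IsAncestor x i := by
      intro x h
      induction h using Relation.TransGen.head_induction_on with
      | single he =>
        intro hx
        obtain ⟨-, hk | hk⟩ := arrow_reduce_directedWalk hG he
        · exact absurd (Or.inr hk.1) hx.2
        · exact hk.2.isAncestor
      | head he _ ih =>
        intro hx
        obtain ⟨hi, hk | hk⟩ := arrow_reduce_directedWalk hG he
        · exact absurd (Or.inr hk.1) hx.2
        · exact hk.2.isAncestor.trans (ih hi)
    refine hG.acyclic i (key i h ?_)
    obtain ⟨c, -, he⟩ := Relation.TransGen.tail'_iff.1 h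
    exact (arrow_reduce_directedWalk hG he).1
  dashed_mem i k h := ⟨h.2.1, h.2.2.1, h.1⟩
  dashed_symm i k h := ⟨h.1.symm, h.2.2.1, h.2.1, hG.walk_symm h.2.2.2⟩
  full_mem i k h := ⟨h.2.1, h.2.2.1, h.1⟩
  full_symm i k h := by
    obtain ⟨hne, hi, hk, a, b, h⟩ := h
    exact ⟨hne.symm, hk, hi, b, a, hG.walk_symm h⟩

end MixedGraph

/-! ### Composition of reductions. -/

namespace MixedGraph

variable {V : Type*} {G : MixedGraph V}

theorem condClosure_mono {S S' : Set V} (h : S ⊆ S') : G.condClosure S ⊆ G.condClosure S' := by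
  rintro x ((hx | hx) | ⟨s, hs, hx⟩)
  exacts [Or.inl (Or.inl hx), Or.inl (Or.inr (h hx)), Or.inr ⟨s, h hs, hx⟩]

/-- A directed walk through `T` towards `s ∉ T` can be prolonged to a node outside `T`. -/
theorem DirectedWalk.exists_notMem {T : Set V} {i j s : V} (h : G.DirectedWalk T i j)
    (hs : s ∉ T) (hj : Relation.ReflTransGen (fun x y => G.arrow y x) j s) :
    ∃ r, r ∉ T ∧ G.DirectedWalk T i r ∧ Relation.ReflTransGen (fun x y => G.arrow y x) r s := by
  induction hj using Relation.ReflTransGen.head_induction_on with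
  | refl => exact ⟨s, hs, h, .refl⟩
  | @head j j' he hj' ih =>
    by_cases hj : j ∈ T
    · exact ih (h.step hj he)
    · exact ⟨j, hj, h, .head he hj'⟩

theorem exists_directedWalk_notMem {T : Set V} {i s : V} (h : G.IsAncestor i s) (hs : s ∉ T) :
    ∃ r, r ∉ T ∧ G.DirectedWalk T i r ∧ Relation.ReflTransGen (fun x y => G.arrow y x) r s := by
  obtain ⟨j, hj, h⟩ := Relation.TransGen.head'_iff.1 h
  exact (DirectedWalk.edge hj).exists_notMem hs h

theorem IsAncestral.reflTransGen_mem {R : Set V} (hR : G.IsAncestral R) {i k : V}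
    (h : Relation.ReflTransGen (fun x y => G.arrow y x) k i) (hi : i ∈ R) : k ∈ R := by
  rcases Relation.reflTransGen_iff_eq_or_transGen.1 h with rfl | h
  · exact hi
  · exact hR.ancestor_mem h hi

theorem arrow_reduce_of_directedWalk (hG : G.IsSummaryGraph) {S T : Set V} {i k : V}
    (h : G.DirectedWalk T i k) (hi : i ∈ G.nodes) (hi' : i ∉ S ∪ T) (hiR : i ∉ G.condClosure S)
    (hk : k ∉ T) : (G.reduce S T).arrow k i := by
  have hkR : k ∉ G.condClosure S := fun hk =>
    hiR ((isAncestral_condClosure hG S).ancestor_mem h.isAncestor hk)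
  refine ⟨?_, ⟨hG.walk_mem_nodes (h.walk ∅), ?_⟩, Or.inl ⟨⟨hi, ?_⟩, hG.walk_symm (h.walk _)⟩⟩
  · rintro rfl
    exact hG.acyclic _ h.isAncestor
  · rintro ((hkS | hkT) | hkR')
    exacts [hkR (Or.inl (Or.inr hkS)), hk hkT, hkR hkR']
  · exact fun h => h.elim hi' hiR

/-- Stretches of the directed path inside `T` are absorbed into single arrows; each visit outside
`T` ends one arrow and begins the next. -/
theorem isAncestor_reduce_of_directedWalk (hG : G.IsSummaryGraph) {S T : Set V} {i j s : V}
    (h : G.DirectedWalk T i j) (hi : i ∈ G.nodes) (hi' : i ∉ S ∪ T) (hiR : i ∉ G.condClosure S)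
    (hs : s ∉ T) (hj : Relation.ReflTransGen (fun x y => G.arrow y x) j s) :
    (G.reduce S T).IsAncestor i s := by
  induction hj using Relation.ReflTransGen.head_induction_on generalizing i with
  | refl => exact .single (arrow_reduce_of_directedWalk hG h hi hi' hiR hs)
  | @head j j' he hj' ih =>
    by_cases hj : j ∈ T
    · exact ih (h.step hj he) hi hi' hiR
    · have hjR : j ∉ G.condClosure S := fun hj =>
        hiR ((isAncestral_condClosure hG S).ancestor_mem h.isAncestor hj)
      refine .head (arrow_reduce_of_directedWalk hG h hi hi' hiR hj) (ih (.edge he)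
        (hG.walk_mem_nodes (h.walk ∅)) ?_ hjR)
      exact fun h => h.elim (fun h => hjR (Or.inl (Or.inr h))) hj

/-- The collision set after two reductions is that of the combined one on the surviving nodes.
Ancestors may become invisible by passing through `R`, but `R` itself becomes part of the new `v`.
-/
theorem mem_condClosure_reduce (hG : G.IsSummaryGraph) {S T S' : Set V}
    (hS' : Disjoint S' T) {x : V} (hx : x ∈ G.nodes) (hx' : x ∉ S ∪ T) :
    x ∈ (G.reduce S T).condClosure S' ↔ x ∈ G.condClosure (S ∪ S') := by
  have hR := isAncestral_condClosure hG S
  have hR₂ := isAncestral_condClosure hG (S ∪ S')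
  have hsub : G.condClosure S ⊆ G.condClosure (S ∪ S') := condClosure_mono Set.subset_union_left
  constructor
  · rintro ((h | h) | ⟨s, hs, h⟩)
    · exact hsub h.1
    · exact Or.inl (Or.inr (Or.inr h))
    · have hs' : s ∈ G.condClosure (S ∪ S') := Or.inl (Or.inr (Or.inr hs))
      clear hx hx'
      induction h using Relation.TransGen.head_induction_on with
      | single he =>
        rcases (arrow_reduce_directedWalk hG he).2 with h | h
        · exact hsub h.1
        · exact hR₂.ancestor_mem h.2.isAncestor hs'
      | head he _ ih =>
        rcases (arrow_reduce_directedWalk hG he).2 with h | h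
        · exact hsub h.1
        · exact hR₂.ancestor_mem h.2.isAncestor ih
  · intro h
    by_cases hxR : x ∈ G.condClosure S
    · exact Or.inl (Or.inl ⟨hxR, hx'⟩)
    rcases h with (h | h | h) | ⟨s, hs | hs, h⟩
    · exact absurd (Or.inl (Or.inl h)) hxR
    · exact absurd (Or.inl h) hx'
    · exact Or.inl (Or.inr h)
    · exact absurd (Or.inr ⟨s, hs, h⟩) hxR
    · obtain ⟨j, hj, h⟩ := Relation.TransGen.head'_iff.1 h
      exact Or.inr ⟨s, hs, isAncestor_reduce_of_directedWalk hG (.edge hj) hx hx' hxR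
        (hS'.notMem_of_mem_left hs) h⟩

/-- Walks in the reduced graph come from walks in the original graph. -/
theorem exists_walk_of_walk_reduce (hG : G.IsSummaryGraph) {S T S' T' : Set V}
    (hS : S ⊆ G.nodes) (hS' : Disjoint S' T) {i k : V} {a b : Bool}
    (h : Walk (G.reduce S T).MarkedEdge ((G.reduce S T).condClosure S') T' i a k b) :
    ∃ a₀ b₀, Walk G.MarkedEdge (G.condClosure (S ∪ S')) (T ∪ T') i a₀ k b₀ ∧
      Seen (G.condClosure S) i a₀ a ∧ Seen (G.condClosure S) k b₀ b := by
  have hsub : G.condClosure S ⊆ G.condClosure (S ∪ S') := condClosure_mono Set.subset_union_left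
  induction h with
  | edge he =>
    obtain ⟨-, -, -, a₀, b₀, h, ha, hb⟩ := (markedEdge_reduce hG hS).1 he
    exact ⟨a₀, b₀, h.mono hsub Set.subset_union_left, ha, hb⟩
  | @step j k b b' c _ hp he ih =>
    obtain ⟨-, hj, -, b₁, c₀, h, hb₁, hc⟩ := (markedEdge_reduce hG hS).1 he
    obtain ⟨a₀, b₀, h', ha, hb⟩ := ih
    refine ⟨a₀, c₀, h'.trans ?_ (h.mono hsub Set.subset_union_left), ha, hc⟩
    rcases hb with ⟨hjR, rfl⟩ | ⟨hjR, rfl⟩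
    -- The forgotten marks at `j` are arbitrary, but `j` lies in both the collision set and `T'`, so
    -- it is passed whatever they are.
    · have hjT : j ∈ T' := by simpa [Passes] using hp
      cases b₀ <;> cases b₁ <;> simp [Passes, hjT, hsub hjR]
    · rcases hb₁ with ⟨hjR', -⟩ | ⟨-, rfl⟩
      · exact absurd hjR' hjR
      · rcases hp with ⟨h1, h2, h3⟩ | ⟨h1, h2⟩
        · exact Or.inl ⟨h1, h2, (mem_condClosure_reduce hG hS' hj.1 hj.2).1 h3⟩
        · exact Or.inr ⟨h1, Or.inr h2⟩

/-- Walks in the original graph are traced by walks in the reduced graph; the marks at the ends are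
kept if the end nodes cannot be passed. -/
theorem exists_walk_reduce_of_walk (hG : G.IsSummaryGraph) {S T S' T' : Set V}
    (hS : S ⊆ G.nodes) (hS' : Disjoint S' T) (hT' : Disjoint T' S) {i k : V} {a b : Bool}
    (hi : i ∈ G.nodes \ (S ∪ T)) (hk : k ∈ G.nodes \ (S ∪ T)) (hne : i ≠ k)
    (h : Walk G.MarkedEdge (G.condClosure (S ∪ S')) (T ∪ T') i a k b) :
    ∃ a' b', Walk (G.reduce S T).MarkedEdge ((G.reduce S T).condClosure S') T' i a' k b' ∧
      (i ∈ G.condClosure (S ∪ S') ∪ T' ∨ Seen (G.condClosure S) i a a') ∧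
      (k ∈ G.condClosure (S ∪ S') ∪ T' ∨ Seen (G.condClosure S) k b b') := by
  have hR := isAncestral_condClosure hG S
  have hsub : G.condClosure S ⊆ G.condClosure (S ∪ S') := condClosure_mono Set.subset_union_left
  have hmem : ∀ {x}, x ∈ G.nodes \ (S ∪ T) → (x ∈ (G.reduce S T).condClosure S' ↔
      x ∈ G.condClosure (S ∪ S')) := fun hx => mem_condClosure_reduce hG hS' hx.1 hx.2
  have hpass : ∀ {m x m'}, x ∈ G.nodes \ (S ∪ T) →
      Passes (G.condClosure (S ∪ S')) (T ∪ T') m x m' →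
      Passes ((G.reduce S T).condClosure S') T' m x m' := by
    rintro m x m' hx (⟨h1, h2, h3⟩ | ⟨h1, h2 | h2⟩)
    exacts [Or.inl ⟨h1, h2, (hmem hx).2 h3⟩, absurd (Or.inr h2) hx.2, Or.inr ⟨h1, h2⟩]
  -- the traced walk has arrived at `l` and may leave it with mark `m`
  let Ready : V → Bool → Prop := fun l m =>
    (l = i ∧ (i ∈ G.condClosure (S ∪ S') ∪ T' ∨ m = a)) ∨
    ∃ a' m₀ m', Walk (G.reduce S T).MarkedEdge ((G.reduce S T).condClosure S') T' i a' l m₀ ∧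
      (i ∈ G.condClosure (S ∪ S') ∪ T' ∨ Seen (G.condClosure S) i a a') ∧
      Seen (G.condClosure S) l m m' ∧ Passes ((G.reduce S T).condClosure S') T' m₀ l m'
  have arrive : ∀ {l m j b}, l ∈ G.nodes \ (S ∪ T) → Ready l m →
      Walk G.MarkedEdge (G.condClosure S) T l m j b → j ∈ G.nodes \ (S ∪ T) → l ≠ j →
      ∃ a' b', Walk (G.reduce S T).MarkedEdge ((G.reduce S T).condClosure S') T' i a' j b' ∧
      (i ∈ G.condClosure (S ∪ S') ∪ T' ∨ Seen (G.condClosure S) i a a') ∧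
      Seen (G.condClosure S) j b b' := by
    intro l m j b hl hready hw hj hlj
    obtain ⟨b', hb'⟩ := exists_seen (G.condClosure S) j b
    rcases hready with ⟨rfl, hm⟩ | ⟨a', m₀, m', hw', ha', hm', hp⟩
    · obtain ⟨m', hm'⟩ := exists_seen (G.condClosure S) l m
      refine ⟨m', b', .edge ((markedEdge_reduce hG hS).2 ⟨hlj, hl, hj, m, b, hw, hm', hb'⟩), ?_,
        hb'⟩
      refine hm.imp id ?_
      rintro rfl
      exact hm'
    · exact ⟨a', b', .step hw' hp
        ((markedEdge_reduce hG hS).2 ⟨hlj, hl, hj, m, b, hw, hm', hb'⟩), ha', hb'⟩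
  -- A surviving node `j` ends one reduced edge and begins the next. Nodes of `R` lose their marks
  -- and become transmitting, whence the demand that they be in `T'`.
  have pause : ∀ {l m j b b'}, l ∈ G.nodes \ (S ∪ T) → Ready l m →
      Walk G.MarkedEdge (G.condClosure S) T l m j b → j ∈ G.nodes \ (S ∪ T) →
      Passes (G.condClosure (S ∪ S')) (T ∪ T') b j b' → (j ∈ G.condClosure S → j ∈ T') →
      Ready j b' := by
    intro l m j b b' hl hready hw hj hp hjR
    obtain ⟨c', hc'⟩ := exists_seen (G.condClosure S) j b'
    by_cases hlj : l = j
    · subst hlj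
      rcases hready with ⟨rfl, hm⟩ | ⟨a', m₀, m', hw', ha', hm', hp'⟩
      · refine Or.inl ⟨rfl, Or.inl ?_⟩
        rcases hp with ⟨-, -, h⟩ | ⟨-, h | h⟩
        exacts [Or.inl h, absurd (Or.inr h) hl.2, Or.inr h]
      · refine Or.inr ⟨a', m₀, c', hw', ha', hc', ?_⟩
        rcases hm' with ⟨h, rfl⟩ | ⟨h, rfl⟩
        · rcases hc' with ⟨-, rfl⟩ | ⟨h', -⟩
          exacts [hp', absurd h h']
        · rcases hc' with ⟨h', -⟩ | ⟨-, rfl⟩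
          · exact absurd h' h
          have hp₂ := hpass hl hp
          -- The section from `l` back to `l` yields no edge and is dropped. This could spoil the
          -- passage only if it had tails at both ends, which is impossible outside `R`.
          by_cases hcase : m' = false ∧ b = false
          · obtain ⟨rfl, rfl⟩ := hcase
            exact absurd (hR.directedWalk hG hw h).1 (by simp)
          · cases m' <;> cases b <;> cases m₀ <;> cases c' <;> simp_all [Passes]
    · obtain ⟨a', c, hw', ha', hc⟩ := arrive hl hready hw hj hlj
      refine Or.inr ⟨a', c, c', hw', ha', hc', ?_⟩
      rcases hc with ⟨h, rfl⟩ | ⟨h, rfl⟩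
      · exact Or.inr ⟨Or.inl rfl, hjR h⟩
      · rcases hc' with ⟨h', -⟩ | ⟨-, rfl⟩
        exacts [absurd h' h, hpass hj hp]
  -- Invariant of the induction: `l` is the last surviving node at which the walk was cut, and the
  -- rest is a walk for a single reduced edge.
  have main : ∃ l m, l ∈ G.nodes \ (S ∪ T) ∧ Ready l m ∧
      Walk G.MarkedEdge (G.condClosure S) T l m k b := by
    clear hk hne
    induction h with
    | edge he => exact ⟨i, a, hi, Or.inl ⟨rfl, Or.inr rfl⟩, .edge he⟩
    | @step j k b b' c hw₀ hp he ih =>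
      obtain ⟨l, m, hl, hready, hw⟩ := ih
      have hjN := hG.walk_mem_nodes hw
      by_cases hp₁ : Passes (G.condClosure S) T b j b'
      · exact ⟨l, m, hl, hready, .step hw hp₁ he⟩
      by_cases hj : j ∈ G.nodes \ (S ∪ T)
      · refine ⟨j, b', hj, pause hl hready hw hj hp ?_, .edge he⟩
        intro hjR
        rcases hp with ⟨h1, h2, -⟩ | ⟨-, h | h⟩
        · exact absurd (Or.inl ⟨h1, h2, hjR⟩) hp₁
        · exact absurd (Or.inr h) hj.2
        · exact h
      · -- a collision at a node of `T` is bypassed by a detour to a descendant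
        have hjST : j ∈ S ∪ T := by_contra fun h => hj ⟨hjN, h⟩
        rcases hp with ⟨rfl, rfl, h3⟩ | ⟨h1, h2⟩
        · have hjR : j ∉ G.condClosure S := fun h => hp₁ (Or.inl ⟨rfl, rfl, h⟩)
          have hjS : j ∉ S := fun h => hjR (Or.inl (Or.inr h))
          have hjT : j ∈ T := hjST.resolve_left hjS
          obtain ⟨s, hs, hanc⟩ : ∃ s ∈ S', G.IsAncestor j s := by
            rcases h3 with (h | h | h) | ⟨s, hs | hs, h⟩
            · exact absurd (Or.inl (Or.inl h)) hjR
            · exact absurd h hjS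
            · exact absurd hjT (hS'.notMem_of_mem_left h)
            · exact absurd (Or.inr ⟨s, hs, h⟩) hjR
            · exact ⟨s, hs, h⟩
          obtain ⟨r, hrT, hd, hr⟩ := exists_directedWalk_notMem hanc (hS'.notMem_of_mem_left hs)
          have hrR : r ∉ G.condClosure S := fun h => hjR (hR.ancestor_mem hd.isAncestor h)
          have hrN : r ∈ G.nodes \ (S ∪ T) :=
            ⟨hG.walk_mem_nodes (hd.walk ∅), fun h => h.elim
              (fun h => hrR (Or.inl (Or.inr h))) hrT⟩
          have hrR₂ : r ∈ G.condClosure (S ∪ S') :=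
            (isAncestral_condClosure hG _).reflTransGen_mem hr (Or.inl (Or.inr (Or.inr hs)))
          refine ⟨r, true, hrN, pause hl hready
            (hw.trans (Or.inr ⟨Or.inr rfl, hjT⟩) (hd.walk _)) hrN (Or.inl ⟨rfl, rfl, hrR₂⟩)
            (fun h => absurd h hrR), ?_⟩
          exact .step (hG.walk_symm (hd.walk _)) (Or.inr ⟨Or.inl rfl, hjT⟩) he
        · rcases h2 with h2 | h2
          · exact absurd (Or.inr ⟨h1, h2⟩) hp₁
          · rcases hjST with h | h
            · exact absurd h (hT'.notMem_of_mem_left h2)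
            · exact absurd (Or.inr ⟨h1, h⟩) hp₁
  obtain ⟨l, m, hl, hready, hw⟩ := main
  by_cases hlk : l = k
  · subst hlk
    rcases hready with ⟨rfl, -⟩ | ⟨a', m₀, m', hw', ha', -, hp⟩
    · exact absurd rfl hne
    · refine ⟨a', m₀, hw', ha', Or.inl ?_⟩
      rcases hp with ⟨-, -, h⟩ | ⟨-, h⟩
      exacts [Or.inl ((hmem hl).1 h), Or.inr h]
  · obtain ⟨a', b', hw', ha', hb'⟩ := arrive hl hready hw hk hlk
    exact ⟨a', b', hw', ha', Or.inr hb'⟩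

/-- Successive reductions can be carried out at once. -/
theorem reduce_reduce (hG : G.IsSummaryGraph) {S T S' T' : Set V} (hS : S ⊆ G.nodes)
    (hS' : S' ⊆ (G.reduce S T).nodes) (hT' : T' ⊆ (G.reduce S T).nodes) :
    (G.reduce S T).reduce S' T' = G.reduce (S ∪ S') (T ∪ T') := by
  have hG' : (G.reduce S T).IsSummaryGraph := isSummaryGraph_reduce hG
  have hN := nodes_reduce hG (S := S) (T := T) hS
  have hS'T : Disjoint S' T := Set.disjoint_left.2 fun x hx hx' =>
    (hN ▸ hS' hx).2 (Or.inr hx')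
  have hT'S : Disjoint T' S := Set.disjoint_left.2 fun x hx hx' =>
    (hN ▸ hT' hx).2 (Or.inl hx')
  have hSS' : S ∪ S' ⊆ G.nodes := Set.union_subset hS fun x hx => (hN ▸ hS' hx).1
  have hmem : ∀ {x}, x ∈ G.nodes \ (S ∪ T) → (x ∈ (G.reduce S T).condClosure S' ↔
      x ∈ G.condClosure (S ∪ S')) := fun hx => mem_condClosure_reduce hG hS'T hx.1 hx.2
  have hsub : G.condClosure S ⊆ G.condClosure (S ∪ S') := condClosure_mono Set.subset_union_left
  have hset : S ∪ S' ∪ (T ∪ T') = S ∪ T ∪ (S' ∪ T') := Set.union_union_union_comm _ _ _ _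
  have hRN' := condClosure_subset hG' hS'
  have hRN := condClosure_subset hG hSS'
  apply ext_markedEdge
  · ext x
    simp only [reduce.eq_1 _ S' T', reduce.eq_1 G (S ∪ S') (T ∪ T'), hN, hset]
    constructor
    · rintro ⟨h, h'⟩
      refine ⟨h.1, ?_⟩
      rintro ((h1 | h1) | h1)
      · exact h.2 h1
      · exact h' (Or.inl h1)
      · exact h' (Or.inr ((hmem h).2 h1))
    · rintro ⟨h, h'⟩
      have hx : x ∈ G.nodes \ (S ∪ T) := ⟨h, fun h => h' (Or.inl (Or.inl h))⟩
      refine ⟨hx, ?_⟩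
      rintro (h1 | h1)
      · exact h' (Or.inl (Or.inr h1))
      · exact h' (Or.inr ((hmem hx).1 h1))
  · ext x
    simp only [reduce.eq_1 _ S' T', reduce.eq_1 G (S ∪ S') (T ∪ T'), hset]
    constructor
    · rintro ⟨h, h'⟩
      have hx : x ∈ G.nodes \ (S ∪ T) := hN ▸ hRN' h
      exact ⟨(hmem hx).1 h, fun h => h.elim hx.2 h'⟩
    · rintro ⟨h, h'⟩
      have hx : x ∈ G.nodes \ (S ∪ T) := ⟨hRN h, fun h => h' (Or.inl h)⟩
      exact ⟨(hmem hx).2 h, fun h => h' (Or.inr h)⟩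
  · intro i a k b
    rw [markedEdge_reduce hG' hS', markedEdge_reduce hG hSS', hN, hset]
    have hnode : ∀ x, x ∈ (G.nodes \ (S ∪ T)) \ (S' ∪ T') ↔
        x ∈ G.nodes \ (S ∪ T ∪ (S' ∪ T')) := fun x => by
      rw [Set.sdiff_sdiff]
    rw [hnode, hnode]
    have hseen : ∀ {x a a₀ a₁}, x ∈ G.nodes \ (S ∪ T) → Seen (G.condClosure S) x a₁ a₀ →
        Seen ((G.reduce S T).condClosure S') x a₀ a → Seen (G.condClosure (S ∪ S')) x a₁ a := by
      rintro x a a₀ a₁ hx h1 (⟨h, rfl⟩ | ⟨h, rfl⟩)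
      · exact Or.inl ⟨(hmem hx).1 h, rfl⟩
      · rw [hmem hx] at h
        rcases h1 with ⟨h1, rfl⟩ | ⟨h1, rfl⟩
        exacts [absurd (hsub h1) h, Or.inr ⟨h, rfl⟩]
    -- The tracing loses an end mark only at a node of the larger closure or of `T'`; in the former
    -- the mark is forgotten anyway, and end nodes avoid the latter.
    have hseen' : ∀ {x a a₀ a₁}, x ∈ G.nodes \ (S ∪ T ∪ (S' ∪ T')) →
        Seen (G.condClosure (S ∪ S')) x a₁ a →
        (x ∈ G.condClosure (S ∪ S') ∪ T' ∨ Seen (G.condClosure S) x a₁ a₀) →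
        Seen ((G.reduce S T).condClosure S') x a₀ a := by
      intro x a a₀ a₁ hx h1 h2
      have hx' : x ∈ G.nodes \ (S ∪ T) := ⟨hx.1, fun h => hx.2 (Or.inl h)⟩
      rcases h1 with ⟨h1, rfl⟩ | ⟨h1, rfl⟩
      · exact Or.inl ⟨(hmem hx').2 h1, rfl⟩
      · refine Or.inr ⟨fun h => h1 ((hmem hx').1 h), ?_⟩
        rcases h2 with (h2 | h2) | ⟨h2, rfl⟩ | ⟨h2, rfl⟩
        exacts [absurd h2 h1, absurd (Or.inr (Or.inr h2)) hx.2, absurd (hsub h2) h1, rfl]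
    refine and_congr_right fun hne => and_congr_right fun hi => and_congr_right fun hk => ?_
    have hi' : i ∈ G.nodes \ (S ∪ T) := ⟨hi.1, fun h => hi.2 (Or.inl h)⟩
    have hk' : k ∈ G.nodes \ (S ∪ T) := ⟨hk.1, fun h => hk.2 (Or.inl h)⟩
    constructor
    · rintro ⟨a₀, b₀, h, ha, hb⟩
      obtain ⟨a₁, b₁, h, ha₁, hb₁⟩ := exists_walk_of_walk_reduce hG hS hS'T h
      exact ⟨a₁, b₁, h, hseen hi' ha₁ ha, hseen hk' hb₁ hb⟩
    · rintro ⟨a₁, b₁, h, ha, hb⟩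
      obtain ⟨a₀, b₀, h, ha₀, hb₀⟩ :=
        exists_walk_reduce_of_walk hG hS hS'T hT'S hi' hk' hne h
      exact ⟨a₀, b₀, h, hseen' hi ha ha₀, hseen' hk hb hb₀⟩

end MixedGraph

/-! ### The procedure computes the reduction. -/

namespace MixedGraph

variable {V : Type*} {G : MixedGraph V}

theorem Walk.edge_of_empty {E : V → Bool → V → Bool → Prop} {i k : V} {a b : Bool}
    (h : Walk E ∅ ∅ i a k b) : E i a k b := by
  cases h with
  | edge he => exact he
  | step _ hp _ => simp [Passes] at hp

/-- Splitting a walk at its first and last collision at `x`. -/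
theorem Walk.split_collision {E : V → Bool → V → Bool → Prop} {R T : Set V} {x i k : V}
    {a b : Bool} (h : Walk E (insert x R) T i a k b) :
    Walk E R T i a k b ∨ (Walk E R T i a x true ∧ Walk E R T x true k b) := by
  induction h with
  | edge he => exact Or.inl (.edge he)
  | @step j k b b' c _ hp he ih =>
    by_cases hp' : Passes R T b j b'
    · exact ih.imp (fun h => .step h hp' he) (fun h => ⟨h.1, .step h.2 hp' he⟩)
    · rcases hp with ⟨rfl, rfl, rfl | h3⟩ | h
      · exact Or.inr ⟨ih.elim id (·.1), .edge he⟩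
      · exact absurd (Or.inl ⟨rfl, rfl, h3⟩) hp'
      · exact absurd (Or.inr h) hp'

/-- Splitting a walk at its first and last transmission at the node of `T`. -/
theorem Walk.split_transmission {E : V → Bool → V → Bool → Prop} {R T : Set V}
    (hT : T.Subsingleton) {i k : V} {a b : Bool} (h : Walk E R T i a k b) :
    Walk E R ∅ i a k b ∨ ∃ t ∈ T, ∃ m m', Walk E R ∅ i a t m ∧ Walk E R ∅ t m' k b ∧
      (m = false ∨ m' = false ∨ Walk E R T t false t false) := by
  induction h with
  | edge he => exact Or.inl (.edge he)
  | @step j k b b' c _ hp he ih =>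
    rcases hp with ⟨h1, h2, h3⟩ | ⟨h1, h2⟩
    · have hp' : Passes R ∅ b j b' := Or.inl ⟨h1, h2, h3⟩
      refine ih.imp (fun h => .step h hp' he) ?_
      rintro ⟨t, ht, m, m', h, h', hm⟩
      exact ⟨t, ht, m, m', h, .step h' hp' he, hm⟩
    · right
      rcases ih with h | ⟨t, ht, m, m', h, h', hm⟩
      · exact ⟨j, h2, b, b', h, .edge he, h1.imp id Or.inl⟩
      · obtain rfl := hT ht h2
        refine ⟨t, ht, m, b', h, .edge he, ?_⟩
        -- If the first arrival and the last departure both carry `true`, the first departure and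
        -- the last arrival are tails, so the part in between is a loop with two tails.
        cases m
        · exact Or.inl rfl
        cases b'
        · exact Or.inr (Or.inl rfl)
        obtain rfl : b = false := by simpa using h1
        rcases hm with hm | rfl | hm
        · cases hm
        · exact Or.inr (Or.inr (h'.mono subset_rfl (Set.empty_subset _)))
        · exact Or.inr (Or.inr hm)

/-- Collisions outside `v` and outside the marginalising set suffice. -/
theorem walk_condClosure (hG : G.IsSummaryGraph) {S T : Set V} (hST : Disjoint S T) {i k : V}
    {a b : Bool} (h : Walk G.MarkedEdge (G.condClosure S) T i a k b) :
    Walk G.MarkedEdge ((S ∪ G.ancestors S) \ T) T i a k b := by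
  induction h with
  | edge he => exact .edge he
  | @step j k b b' c hw hp he ih =>
    rcases hp with ⟨rfl, rfl, h3⟩ | hp
    · have hj : j ∈ S ∪ G.ancestors S := by
        rcases h3 with (h3 | h3) | h3
        · exact absurd h3 (hG.disjoint.notMem_of_mem_left (hG.walk_mem_u hw))
        · exact Or.inl h3
        · exact Or.inr h3
      by_cases hjT : j ∈ T
      · obtain ⟨s, hs, hanc⟩ := hj.resolve_left (fun h => hST.notMem_of_mem_left h hjT)
        obtain ⟨r, hrT, hd, hr⟩ := exists_directedWalk_notMem hanc (hST.notMem_of_mem_left hs)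
        have hrS : r ∈ S ∪ G.ancestors S := by
          rcases Relation.reflTransGen_iff_eq_or_transGen.1 hr with rfl | hr
          exacts [Or.inl hs, Or.inr ⟨s, hs, hr⟩]
        refine .step (((ih.trans (Or.inr ⟨Or.inr rfl, hjT⟩) (hd.walk _)).trans
          (Or.inl ⟨rfl, rfl, hrS, hrT⟩) (hG.walk_symm (hd.walk _)))) (Or.inr ⟨Or.inl rfl, hjT⟩) he
      · exact .step ih (Or.inl ⟨rfl, rfl, hj, hjT⟩) he
    · exact .step ih (Or.inr hp) he

/-- Dashed and full lines are symmetric. -/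
def SymmetricLines (G : MixedGraph V) : Prop :=
  (∀ i k, G.dashed i k → G.dashed k i) ∧ ∀ i k, G.full i k → G.full k i

theorem SymmetricLines.condStep (h : G.SymmetricLines) (X : Set V) (x : V) :
    (G.condStep X x).SymmetricLines := by
  refine ⟨?_, ?_⟩
  · rintro i k (hd | ⟨h1, h2, h3, h4, h5, h6⟩)
    · exact Or.inl (h.1 _ _ hd)
    · exact Or.inr ⟨h1.symm, h3, h2, h4, h.1 _ _ h6, h.1 _ _ h5⟩
  · rintro i k (hd | ⟨h1, h2, h3, h4, h5, h6⟩)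
    · exact Or.inl (h.2 _ _ hd)
    · exact Or.inr ⟨h1.symm, h3, h2, h4, h6, h5⟩

theorem SymmetricLines.condSteps (h : G.SymmetricLines) (X : Set V) (L : List V) :
    (G.condSteps X L).SymmetricLines := by
  induction L generalizing G with
  | nil => exact h
  | cons x L ih => exact ih (h.condStep X x)

theorem SymmetricLines.margStep (h : G.SymmetricLines) (X T : Set V) :
    (G.margStep X T).SymmetricLines := by
  refine ⟨?_, ?_⟩
  · rintro i k (hd | ⟨h1, h2, h3, t, ht, ht', h4⟩)
    · exact Or.inl (h.1 _ _ hd)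
    · refine Or.inr ⟨h1.symm, h3, h2, t, ht, ht', ?_⟩
      rcases h4 with h4 | h4 | h4
      exacts [Or.inl h4.symm, Or.inr (Or.inr ⟨h.1 _ _ h4.2, h4.1⟩),
        Or.inr (Or.inl ⟨h4.2, h.1 _ _ h4.1⟩)]
  · rintro i k (hd | ⟨h1, h2, h3, t, ht, ht', h4⟩)
    · exact Or.inl (h.2 _ _ hd)
    · refine Or.inr ⟨h1.symm, h3, h2, t, ht, ht', ?_⟩
      rcases h4 with h4 | h4 | h4
      exacts [Or.inl ⟨h.2 _ _ h4.2, h.2 _ _ h4.1⟩, Or.inr (Or.inr ⟨h4.2, h.2 _ _ h4.1⟩),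
        Or.inr (Or.inl ⟨h.2 _ _ h4.2, h4.1⟩)]

/-- All the rules for conditioning are one: two edges with mark `true` at `x` are joined, keeping
their outer marks. -/
theorem markedEdge_condStep (h : G.SymmetricLines) (X : Set V) (x i k : V) (a b : Bool) :
    (G.condStep X x).MarkedEdge i a k b ↔ G.MarkedEdge i a k b ∨
      (i ≠ k ∧ i ∉ X ∧ k ∉ X ∧ x ∉ X ∧ G.MarkedEdge i a x true ∧ G.MarkedEdge x true k b) := by
  have hd : ∀ i k, G.dashed i k ↔ G.dashed k i := fun i k => ⟨h.1 _ _, h.1 _ _⟩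
  cases a <;> cases b <;> simp only [MarkedEdge, condStep]
  rw [hd k x, ne_comm]
  tauto

/-- Likewise all the rules for marginalising join two edges at `t` unless both marks there are
`true`. -/
theorem markedEdge_margStep (h : G.SymmetricLines) (X T : Set V) (i k : V) (a b : Bool) :
    (G.margStep X T).MarkedEdge i a k b ↔ G.MarkedEdge i a k b ∨
      (i ≠ k ∧ i ∉ X ∧ k ∉ X ∧ ∃ t ∈ T, t ∉ X ∧ ∃ m m', (m = false ∨ m' = false) ∧
        G.MarkedEdge i a t m ∧ G.MarkedEdge t m' k b) := by
  have hd : ∀ i k, G.dashed i k ↔ G.dashed k i := fun i k => ⟨h.1 _ _, h.1 _ _⟩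
  have hf : ∀ i k, G.full i k ↔ G.full k i := fun i k => ⟨h.2 _ _, h.2 _ _⟩
  have hex : ∀ P : Bool → Bool → Prop, (∃ m m', (m = false ∨ m' = false) ∧ P m m') ↔
      P false false ∨ P false true ∨ P true false := by
    intro P; simp; tauto
  cases a <;> cases b <;> simp only [hex, MarkedEdge, margStep]
  · have : ∀ t, G.dashed k t ∧ G.full t i ↔ G.full i t ∧ G.dashed t k := fun t => by
      rw [hd k t, hf t i]; tauto
    have e : ∀ t, G.arrow k t ∧ G.full t i ↔ G.full i t ∧ G.arrow k t := fun t => by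
      rw [hf t i]; tauto
    have e' : ∀ t, G.arrow k t ∧ G.arrow t i ↔ G.arrow t i ∧ G.arrow k t := fun t => and_comm
    simp only [this, e, e']
    rw [ne_comm]
    refine or_congr_right ⟨?_, ?_⟩
    · rintro ⟨h1, h2, h3, t, ht, ht', h4⟩
      exact ⟨h1, h3, h2, t, ht, ht', by tauto⟩
    · rintro ⟨h1, h2, h3, t, ht, ht', h4⟩
      exact ⟨h1, h3, h2, t, ht, ht', by tauto⟩

theorem condSteps_append_singleton (X : Set V) (L : List V) (x : V) :
    G.condSteps X (L ++ [x]) = (G.condSteps X L).condStep X x := by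
  simp [condSteps]

theorem walk_of_markedEdge_condSteps {E : V → Bool → V → Bool → Prop} {R T : Set V}
    (hG : G.SymmetricLines) (hE : ∀ i a k b, G.MarkedEdge i a k b → Walk E R T i a k b)
    (X : Set V) (L : List V) (hL : ∀ x ∈ L, x ∈ R) (i : V) (a : Bool) (k : V) (b : Bool)
    (h : (G.condSteps X L).MarkedEdge i a k b) : Walk E R T i a k b := by
  induction L using List.reverseRecOn generalizing i a k b with
  | nil => exact hE _ _ _ _ h
  | append_singleton L x ih =>
    have ih := ih fun y hy => hL y (by simp [hy])
    rw [condSteps_append_singleton, markedEdge_condStep (hG.condSteps X L)] at h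
    rcases h with h | ⟨-, -, -, -, h, h'⟩
    · exact ih _ _ _ _ h
    · exact (ih _ _ _ _ h).trans (Or.inl ⟨rfl, rfl, hL x (by simp)⟩) (ih _ _ _ _ h')

theorem walk_of_markedEdge_margStep {E : V → Bool → V → Bool → Prop} {R T : Set V}
    (hG : G.SymmetricLines) (hE : ∀ i a k b, G.MarkedEdge i a k b → Walk E R T i a k b)
    (X : Set V) (i : V) (a : Bool) (k : V) (b : Bool)
    (h : (G.margStep X T).MarkedEdge i a k b) : Walk E R T i a k b := by
  rw [markedEdge_margStep hG] at h
  rcases h with h | ⟨-, -, -, t, ht, -, m, m', hm, h, h'⟩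
  · exact hE _ _ _ _ h
  · exact (hE _ _ _ _ h).trans (Or.inr ⟨hm, ht⟩) (hE _ _ _ _ h')

theorem markedEdge_condSteps_ne (hG : G.SymmetricLines)
    (hE : ∀ i a k b, G.MarkedEdge i a k b → i ≠ k)
    (X : Set V) (L : List V) (i : V) (a : Bool) (k : V) (b : Bool)
    (h : (G.condSteps X L).MarkedEdge i a k b) : i ≠ k := by
  induction L using List.reverseRecOn generalizing i a k b with
  | nil => exact hE _ _ _ _ h
  | append_singleton L x ih =>
    rw [condSteps_append_singleton, markedEdge_condStep (hG.condSteps X L)] at h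
    exact h.elim (ih _ _ _ _) (·.1)

/-- Inducing edges around the nodes of `L`, one after the other, traces all walks with collisions
in `L`; the marks at the ends are kept outside `L`. -/
theorem exists_markedEdge_condSteps {E : V → Bool → V → Bool → Prop} {X T : Set V}
    (hG : G.SymmetricLines)
    (hE : ∀ i a k b, i ≠ k → i ∉ X → k ∉ X → Walk E ∅ T i a k b → G.MarkedEdge i a k b)
    (L : List V) (hL : ∀ x ∈ L, x ∉ X) {i k : V} {a b : Bool} (hne : i ≠ k) (hi : i ∉ X)
    (hk : k ∉ X) (h : Walk E {x | x ∈ L} T i a k b) :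
    ∃ a' b', (G.condSteps X L).MarkedEdge i a' k b' ∧ (i ∈ L ∨ a' = a) ∧ (k ∈ L ∨ b' = b) := by
  induction L using List.reverseRecOn generalizing i a k b with
  | nil =>
    refine ⟨a, b, hE _ _ _ _ hne hi hk ?_, Or.inr rfl, Or.inr rfl⟩
    exact h.mono (by simp) subset_rfl
  | append_singleton L x ih =>
    have ih' := fun {i k a b} => @ih (fun y hy => hL y (by simp [hy])) i k a b
    have hx : x ∉ X := hL x (by simp)
    have lift : ∀ {i k a b}, i ≠ k → i ∉ X → k ∉ X → Walk E {x | x ∈ L} T i a k b →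
        ∃ a' b', (G.condSteps X (L ++ [x])).MarkedEdge i a' k b' ∧ (i ∈ L ∨ a' = a) ∧
          (k ∈ L ∨ b' = b) := by
      intro i k a b hne hi hk h
      obtain ⟨a', b', h, ha, hb⟩ := ih' hne hi hk h
      refine ⟨a', b', ?_, ha, hb⟩
      rw [condSteps_append_singleton, markedEdge_condStep (hG.condSteps X L)]
      exact Or.inl h
    have weaken : (∃ a' b', (G.condSteps X (L ++ [x])).MarkedEdge i a' k b' ∧
        (i ∈ L ++ [x] ∨ a' = a) ∧ (k ∈ L ++ [x] ∨ b' = b)) ↔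
        ∃ a' b', (G.condSteps X (L ++ [x])).MarkedEdge i a' k b' ∧
        ((i ∈ L ∨ i = x) ∨ a' = a) ∧ ((k ∈ L ∨ k = x) ∨ b' = b) := by simp
    rw [weaken]
    have hset : {y | y ∈ L ++ [x]} = insert x {y | y ∈ L} := by
      ext y; simp [or_comm]
    rw [hset] at h
    by_cases hxL : x ∈ L
    · rw [Set.insert_eq_of_mem (by exact hxL)] at h
      obtain ⟨a', b', h, ha, hb⟩ := lift hne hi hk h
      exact ⟨a', b', h, ha.imp Or.inl id, hb.imp Or.inl id⟩
    rcases h.split_collision with h | ⟨h, h'⟩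
    · obtain ⟨a', b', h, ha, hb⟩ := lift hne hi hk h
      exact ⟨a', b', h, ha.imp Or.inl id, hb.imp Or.inl id⟩
    by_cases hix : i = x
    · subst hix
      obtain ⟨a', b', h, ha, hb⟩ := lift hne hi hk h'
      exact ⟨a', b', h, Or.inl (Or.inr rfl), hb.imp Or.inl id⟩
    by_cases hkx : k = x
    · subst hkx
      obtain ⟨a', b', h, ha, hb⟩ := lift hne hi hk h
      exact ⟨a', b', h, ha.imp Or.inl id, Or.inl (Or.inr rfl)⟩
    -- Since `x` was not treated before, both edges still have mark `true` at `x`, so the step at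
    -- `x` joins them. Marks at other treated nodes may differ with the order, but retyping forgets
    -- them.
    · obtain ⟨a', m, h, ha, hm⟩ := ih' hix hi hx h
      obtain ⟨m', b', h', hm', hb⟩ := ih' (Ne.symm hkx) hx hk h'
      obtain rfl := hm.resolve_left hxL
      obtain rfl := hm'.resolve_left hxL
      refine ⟨a', b', ?_, ha.imp Or.inl id, hb.imp Or.inl id⟩
      rw [condSteps_append_singleton, markedEdge_condStep (hG.condSteps X L)]
      exact Or.inr ⟨hne, hi, hk, hx, h, h'⟩

theorem newV_eq (hG : G.IsSummaryGraph) (S T : Set V) :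
    G.newV S T = G.condClosure S \ (S ∪ T) := by
  have := hG.ancestors_subset S
  ext x
  simp only [newV, condClosure, Set.mem_sdiff, Set.mem_union, Set.mem_inter_iff]
  refine and_congr_left fun h => ?_
  constructor
  · tauto
  · rintro ((h1 | h1) | h1)
    · exact Or.inl h1
    · exact absurd (Or.inl h1) h
    · exact (this h1).elim (fun h2 => Or.inr ⟨h1, h2⟩) Or.inl

theorem newU_eq (hG : G.IsSummaryGraph) (S T : Set V) :
    G.newU S T = G.nodes \ (S ∪ T ∪ G.condClosure S) := by
  rw [newU, newV_eq hG, Set.union_sdiff_self]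

/-- Re-typing a graph whose edges trace the walks of `G` yields the reduced graph. -/
theorem retype_eq_reduce (hG : G.IsSummaryGraph) {S T : Set V} (hS : S ⊆ G.nodes)
    {K : MixedGraph V} (hne : ∀ i a k b, K.MarkedEdge i a k b → i ≠ k)
    (sound : ∀ i a k b, K.MarkedEdge i a k b → Walk G.MarkedEdge (G.condClosure S) T i a k b)
    (complete : ∀ i a k b, i ∈ G.nodes \ (S ∪ T) → k ∈ G.nodes \ (S ∪ T) → i ≠ k →
      Walk G.MarkedEdge (G.condClosure S) T i a k b → ∃ a' b', K.MarkedEdge i a' k b' ∧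
        (i ∈ G.condClosure S ∨ a' = a) ∧ (k ∈ G.condClosure S ∨ b' = b)) :
    retype (G.newU S T) (G.newV S T) K = G.reduce S T := by
  have hR := isAncestral_condClosure hG S
  have hRN := condClosure_subset hG hS
  have hu : ∀ {x}, x ∈ G.nodes \ (S ∪ T ∪ G.condClosure S) → x ∈ G.nodes \ (S ∪ T) ∧
      x ∉ G.condClosure S := fun hx => ⟨⟨hx.1, fun h => hx.2 (Or.inl h)⟩, fun h => hx.2 (Or.inr h)⟩
  have hv : ∀ {x}, x ∈ G.condClosure S \ (S ∪ T) → x ∈ G.nodes \ (S ∪ T) :=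
    fun hx => ⟨hRN hx.1, hx.2⟩
  rw [newU_eq hG, newV_eq hG]
  apply MixedGraph.ext
  · rfl
  · rfl
  · funext i k
    simp only [retype, reduce, coupled_iff, eq_iff_iff]
    constructor
    · rintro (⟨hi, hk, h⟩ | ⟨hi, hk, a, b, h⟩)
      · exact ⟨hne i true k false h, hi, Or.inl ⟨hk, sound i true k false h⟩⟩
      · exact ⟨hne _ _ _ _ h, hi, Or.inr ⟨hk, a, b, sound _ _ _ _ h⟩⟩
    · rintro ⟨hne, hi, ⟨hk, h⟩ | ⟨hk, a, b, h⟩⟩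
      · obtain ⟨a', b', h, ha, hb⟩ := complete _ _ _ _ (hu hi).1 (hu hk).1 hne h
        obtain rfl := ha.resolve_left (hu hi).2
        obtain rfl := hb.resolve_left (hu hk).2
        exact Or.inl ⟨hi, hk, h⟩
      · obtain ⟨a', b', h, -, -⟩ := complete _ _ _ _ (hu hi).1 (hv hk) hne h
        exact Or.inr ⟨hi, hk, a', b', h⟩
  · funext i k
    simp only [retype, reduce, eq_iff_iff]
    constructor
    · rintro ⟨hi, hk, h⟩
      exact ⟨hne i true k true h, hi, hk, sound i true k true h⟩
    · rintro ⟨hne, hi, hk, h⟩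
      obtain ⟨a', b', h, ha, hb⟩ := complete _ _ _ _ (hu hi).1 (hu hk).1 hne h
      obtain rfl := ha.resolve_left (hu hi).2
      obtain rfl := hb.resolve_left (hu hk).2
      exact ⟨hi, hk, h⟩
  · funext i k
    simp only [retype, reduce, coupled_iff, eq_iff_iff]
    constructor
    · rintro (⟨hi, hk, h⟩ | ⟨hi, hk, a, b, h⟩)
      -- No full line is left within `u'`: a walk from a node outside `R` cannot have tails at both
      -- ends.
      · exact absurd (hR.directedWalk hG (sound i false k false h) (hu hi).2).1 (by simp)
      · exact ⟨hne _ _ _ _ h, hi, hk, a, b, sound _ _ _ _ h⟩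
    · rintro ⟨hne, hi, hk, a, b, h⟩
      obtain ⟨a', b', h, -, -⟩ := complete _ _ _ _ (hv hi) (hv hk) hne h
      exact Or.inr ⟨hi, hk, a', b', h⟩

/-- Marginalising first traces the walks without collisions; conditioning then joins them at
collisions. Ancestors of `S` in `T` can be skipped because `walk_condClosure` bypasses collisions
there. -/
theorem retype_condSteps_margStep (hG : G.IsSummaryGraph) {S T : Set V} (hT : T.Subsingleton)
    (hS : S ⊆ G.nodes) (hST : Disjoint S T) {L : List V}
    (hL : ∀ a, a ∈ L ↔ a ∈ (S ∪ G.ancestors S) \ T) :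
    retype (G.newU S T) (G.newV S T) (condSteps T (margStep ∅ T G) L) = G.reduce S T := by
  have hsym : G.SymmetricLines := ⟨hG.dashed_symm, hG.full_symm⟩
  have hLR : ∀ x ∈ L, x ∈ G.condClosure S := fun x hx =>
    ((hL x).1 hx).1.elim (fun h => Or.inl (Or.inr h)) Or.inr
  apply retype_eq_reduce hG hS
  · apply markedEdge_condSteps_ne (hsym.margStep _ _)
    intro i a k b h
    rw [markedEdge_margStep hsym] at h
    exact h.elim hG.markedEdge_ne (·.1)
  · exact walk_of_markedEdge_condSteps (hsym.margStep _ _)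
      (walk_of_markedEdge_margStep hsym (fun _ _ _ _ h => .edge h) _) _ _ hLR
  · intro i a k b hi hk hne h
    have hset : {x | x ∈ L} = (S ∪ G.ancestors S) \ T := Set.ext hL
    have h := walk_condClosure hG hST h
    rw [← hset] at h
    have base : ∀ i a k b, i ≠ k → i ∉ T → k ∉ T → Walk G.MarkedEdge ∅ T i a k b →
        (margStep ∅ T G).MarkedEdge i a k b := by
      intro i a k b hne hi hk h
      rw [markedEdge_margStep hsym]
      rcases h.split_transmission hT with h | ⟨t, ht, m, m', h, h', hm⟩
      · exact Or.inl h.edge_of_empty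
      · refine Or.inr ⟨hne, by simp, by simp, t, ht, by simp, m, m', ?_, h.edge_of_empty,
          h'.edge_of_empty⟩
        rcases hm with hm | hm | hm
        · exact Or.inl hm
        · exact Or.inr hm
        -- Without collisions, the last edge of such a loop would join `t` to itself, as `t` is the
        -- only node of `T`.
        · exfalso
          cases hm with
          | edge he => exact hG.markedEdge_ne he rfl
          | step _ hp he =>
            rcases hp with ⟨-, -, h⟩ | ⟨-, h⟩
            exacts [h, hG.markedEdge_ne he (hT h ht)]
    obtain ⟨a', b', h, ha, hb⟩ := exists_markedEdge_condSteps (hsym.margStep _ _) base L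
      (fun x hx => ((hL x).1 hx).2) hne (fun h => hi.2 (Or.inr h)) (fun h => hk.2 (Or.inr h)) h
    exact ⟨a', b', h, ha.imp (hLR _) id, hb.imp (hLR _) id⟩

/-- Here conditioning may change the marks at `t` before the marginalising step uses them; the proof
shows that no edge is lost. -/
theorem retype_margStep_condSteps (hG : G.IsSummaryGraph) {S T : Set V} (hT : T.Subsingleton)
    (hS : S ⊆ G.nodes) (hST : Disjoint S T) {L : List V}
    (hL : ∀ a, a ∈ L ↔ a ∈ S ∪ G.ancestors S) :
    retype (G.newU S T) (G.newV S T) (margStep S T (condSteps ∅ G L)) = G.reduce S T := by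
  have hsym : G.SymmetricLines := ⟨hG.dashed_symm, hG.full_symm⟩
  have hLR : ∀ x ∈ L, x ∈ G.condClosure S := fun x hx =>
    ((hL x).1 hx).elim (fun h => Or.inl (Or.inr h)) Or.inr
  have complete : ∀ {i a k b}, i ≠ k → Walk G.MarkedEdge {x | x ∈ L} ∅ i a k b →
      ∃ a' b', (G.condSteps ∅ L).MarkedEdge i a' k b' ∧ (i ∈ L ∨ a' = a) ∧ (k ∈ L ∨ b' = b) :=
    fun {i a k b} hne h => exists_markedEdge_condSteps hsym
      (fun i a k b _ _ _ h => h.edge_of_empty) L (by simp) hne (by simp) (by simp) h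
  apply retype_eq_reduce hG hS
  · intro i a k b h
    rw [markedEdge_margStep (hsym.condSteps _ _)] at h
    exact h.elim (markedEdge_condSteps_ne hsym (fun _ _ _ _ => hG.markedEdge_ne) _ _ _ _ _ _)
      (·.1)
  · exact walk_of_markedEdge_margStep (hsym.condSteps _ _)
      (walk_of_markedEdge_condSteps hsym (fun _ _ _ _ h => .edge h) _ _ hLR) _
  · intro i a k b hi hk hne h
    have hset : {x | x ∈ L} = S ∪ G.ancestors S := Set.ext hL
    have h := (walk_condClosure hG hST h).mono Set.sdiff_subset subset_rfl
    rw [← hset] at h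
    simp only [markedEdge_margStep (hsym.condSteps ∅ L)]
    have keep : ∀ {a b}, Walk G.MarkedEdge {x | x ∈ L} ∅ i a k b → ∃ a' b',
        (G.condSteps ∅ L).MarkedEdge i a' k b' ∧ (i ∈ G.condClosure S ∨ a' = a) ∧
          (k ∈ G.condClosure S ∨ b' = b) := by
      intro a b h
      obtain ⟨a', b', h, ha, hb⟩ := complete hne h
      exact ⟨a', b', h, ha.imp (hLR _) id, hb.imp (hLR _) id⟩
    rcases h.split_transmission hT with h | ⟨t, ht, m, m', h, h', hm⟩
    · obtain ⟨a', b', h, ha, hb⟩ := keep h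
      exact ⟨a', b', Or.inl h, ha, hb⟩
    · have hit : i ≠ t := fun e => hi.2 (Or.inr (e ▸ ht))
      have hkt : t ≠ k := fun e => hk.2 (Or.inr (e ▸ ht))
      obtain ⟨a', n, h₁, ha, hn⟩ := complete hit h
      obtain ⟨n', b', h₂, hn', hb⟩ := complete hkt h'
      by_cases hnn : n = false ∨ n' = false
      · exact ⟨a', b', Or.inr ⟨hne, fun h => hi.2 (Or.inl h), fun h => hk.2 (Or.inl h), t, ht,
          hST.notMem_of_mem_right ht, n, n', hnn, h₁, h₂⟩, ha.imp (hLR _) id, hb.imp (hLR _) id⟩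
      · obtain ⟨rfl, rfl⟩ : n = true ∧ n' = true := by simpa using hnn
        -- Marginalising does not join the two edges, as both have mark `true` at `t`. If `t` is in
        -- `L`, they meet in an open collision and conditioning already supplied the edge; if not,
        -- the original marks were `true` too and force an impossible loop with two tails outside
        -- `R`.
        by_cases htL : t ∈ L
        · have sound := walk_of_markedEdge_condSteps (R := {x | x ∈ L}) (T := ∅) hsym
            (fun _ _ _ _ h => .edge h) ∅ L (fun _ h => h)
          obtain ⟨a₂, b₂, h₃, ha₂, hb₂⟩ := keep ((sound _ _ _ _ h₁).trans
            (Or.inl ⟨rfl, rfl, htL⟩) (sound _ _ _ _ h₂))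
          refine ⟨a₂, b₂, Or.inl h₃, ?_, ?_⟩
          · rcases ha with ha | rfl
            exacts [Or.inl (hLR _ ha), ha₂]
          · rcases hb with hb | rfl
            exacts [Or.inl (hLR _ hb), hb₂]
        · obtain rfl := hn.resolve_left htL
          obtain rfl := hn'.resolve_left htL
          have htR : t ∉ G.condClosure S := by
            rintro ((h3 | h3) | h3)
            · exact hG.disjoint.notMem_of_mem_left (hG.walk_mem_u h) h3
            · exact htL ((hL t).2 (Or.inl h3))
            · exact htL ((hL t).2 (Or.inr h3))
          have hloop : Walk G.MarkedEdge {x | x ∈ L} T t false t false := by simpa using hm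
          exact absurd ((isAncestral_condClosure hG S).directedWalk hG
            (hloop.mono hLR subset_rfl) htR).1 (by simp)

variable [Finite V]

theorem generates_iff (hG : G.IsSummaryGraph) {S T : Set V} (hT : T.Subsingleton)
    (hS : S ⊆ G.nodes) (hST : Disjoint S T) {H : MixedGraph V} :
    G.Generates S T H ↔ H = G.reduce S T := by
  constructor
  · rintro ⟨L, hL, rfl⟩
    exact retype_condSteps_margStep hG hT hS hST hL
  · rintro rfl
    -- Finiteness of `V` serves to list the ancestors, so that the procedure has a result at all.
    refine ⟨((S ∪ G.ancestors S) \ T).toFinite.toFinset.toList, ?_, ?_⟩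
    · simp
    · exact (retype_condSteps_margStep hG hT hS hST (by simp)).symm

theorem generatesCondFirst_iff (hG : G.IsSummaryGraph) {S T : Set V} (hT : T.Subsingleton)
    (hS : S ⊆ G.nodes) (hST : Disjoint S T) {H : MixedGraph V} :
    G.GeneratesCondFirst S T H ↔ H = G.reduce S T := by
  constructor
  · rintro ⟨L, hL, rfl⟩
    exact retype_margStep_condSteps hG hT hS hST hL
  · rintro rfl
    refine ⟨(S ∪ G.ancestors S).toFinite.toFinset.toList, ?_, ?_⟩
    · simp
    · exact (retype_margStep_condSteps hG hT hS hST (by simp)).symm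

end MixedGraph

/-! ### Independence statements in terms of walks. -/

namespace MixedGraph

variable {V : Type*} {G : MixedGraph V}

/-- The mark of an edge at its left node. -/
def EdgeType.leftMark : EdgeType → Bool
  | .left => true
  | .right => false
  | .dashed => true
  | .full => false

/-- The mark of an edge at its right node. -/
def EdgeType.rightMark : EdgeType → Bool
  | .left => false
  | .right => true
  | .dashed => true
  | .full => false

theorem hasEdge_iff (e : EdgeType) (x y : V) :
    G.HasEdge e x y ↔ G.MarkedEdge x e.leftMark y e.rightMark := by
  cases e <;> rfl

theorem isCollision_iff (e e' : EdgeType) :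
    IsCollision e e' ↔ e.rightMark = true ∧ e'.leftMark = true := by
  cases e <;> cases e' <;> simp [IsCollision, EdgeType.leftMark, EdgeType.rightMark]

theorem exists_edgeType (a b : Bool) : ∃ e : EdgeType, e.leftMark = a ∧ e.rightMark = b := by
  cases a <;> cases b
  exacts [⟨.full, rfl, rfl⟩, ⟨.right, rfl, rfl⟩, ⟨.left, rfl, rfl⟩, ⟨.dashed, rfl, rfl⟩]

/-- The nodes `x 0, …, x (n + 1)` and the edges `e 0, …, e n` form a walk with inner collision nodes
in `R` and inner transmitting nodes in `T`. -/
structure IsWalkSeq (G : MixedGraph V) (R T : Set V) (n : ℕ) (x : ℕ → V) (e : ℕ → EdgeType) :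
    Prop where
  edge : ∀ j ≤ n, G.MarkedEdge (x j) (e j).leftMark (x (j + 1)) (e j).rightMark
  passes : ∀ j < n, Passes R T (e j).rightMark (x (j + 1)) (e (j + 1)).leftMark

theorem Walk.exists_isWalkSeq {R T : Set V} {i k : V} {a b : Bool}
    (h : Walk G.MarkedEdge R T i a k b) :
    ∃ n x e, G.IsWalkSeq R T n x e ∧ x 0 = i ∧ x (n + 1) = k ∧ (e n).rightMark = b := by
  induction h with
  | @edge k b he =>
    obtain ⟨e, rfl, rfl⟩ := exists_edgeType a b
    refine ⟨0, fun j => if j = 0 then i else k, fun _ => e, ⟨?_, by simp⟩, by simp, by simp, rfl⟩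
    intro j hj
    obtain rfl : j = 0 := by omega
    simpa using he
  | @step j k b b' c _ hp he ih =>
    obtain ⟨n, x, e, hseq, h0, hn, hb⟩ := ih
    obtain ⟨f, rfl, rfl⟩ := exists_edgeType b' c
    refine ⟨n + 1, fun l => if l ≤ n + 1 then x l else k, fun l => if l ≤ n then e l else f,
      ⟨?_, ?_⟩, by simp [h0], by simp, by simp⟩
    · intro l hl
      rcases Nat.lt_or_ge n l with h | h
      · obtain rfl : l = n + 1 := by omega
        simpa [hn] using he
      · simpa [h, Nat.le_succ_of_le h] using hseq.edge l h
    · intro l hl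
      rcases Nat.lt_or_ge l n with h | h
      · simpa [h.le, h, Nat.succ_le_of_lt h] using hseq.passes l h
      · obtain rfl : l = n := by omega
        simpa [hn, hb] using hp

theorem IsWalkSeq.walk {R T : Set V} {n : ℕ} {x : ℕ → V} {e : ℕ → EdgeType}
    (h : G.IsWalkSeq R T n x e) {p : ℕ} (d : ℕ) (hp : p + d ≤ n) :
    Walk G.MarkedEdge R T (x p) (e p).leftMark (x (p + d + 1)) (e (p + d)).rightMark := by
  induction d with
  | zero => exact .edge (h.edge p hp)
  | succ d ih => exact .step (ih (by omega)) (h.passes (p + d) (by omega)) (h.edge _ hp)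

/-- Closed walks can be cut out. -/
theorem IsAncestral.passes_of_closed_walk (hG : G.IsSummaryGraph) {R T : Set V}
    (hR : G.IsAncestral R) {y : V} {m a b m' : Bool} (h : Passes R T m y a)
    (hw : Walk G.MarkedEdge R T y a y b) (h' : Passes R T b y m') : Passes R T m y m' := by
  -- In `R` a collision is open, and any tail among `m`, `m'` already gives `y ∈ T`. Outside `R`,
  -- either `m` is a tail, or the section leaves through a tail, returns through a head, and so `m'`
  -- is a tail.
  by_cases hy : y ∈ R
  · cases m <;> cases m' <;> simp_all [Passes]
  · cases a
    · obtain rfl := (hR.directedWalk hG hw hy).1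
      cases m <;> cases m' <;> simp_all [Passes]
    · cases m <;> cases m' <;> simp_all [Passes]

/-- A closed section from `x (p + 1)` to `x (p + 1 + d)` is cut out of a walk. -/
theorem IsWalkSeq.cut (hG : G.IsSummaryGraph) {R T : Set V} (hR : G.IsAncestral R) {n p d : ℕ}
    {x : ℕ → V} {e : ℕ → EdgeType} (h : G.IsWalkSeq R T n x e) (hd : 0 < d) (hpd : p + d < n)
    (hx : x (p + 1) = x (p + 1 + d)) :
    G.IsWalkSeq R T (n - d) (fun j => if j ≤ p + 1 then x j else x (j + d))
      (fun j => if j ≤ p then e j else e (j + d)) := by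
  constructor
  · intro j hj
    rcases Nat.lt_trichotomy j (p + 1) with hjp | rfl | hjp
    · have h1 : j ≤ p := by omega
      simpa [h1, hjp.le] using h.edge j (by omega)
    · have := h.edge (p + 1 + d) (by omega)
      rw [← hx] at this
      simpa [show p + 1 + 1 + d = p + 1 + d + 1 by omega] using this
    · have h1 : ¬ j ≤ p := by omega
      have h2 : ¬ j ≤ p + 1 := by omega
      simpa [h1, h2, show j + 1 + d = j + d + 1 by omega] using h.edge (j + d) (by omega)
  · intro j hj
    rcases Nat.lt_trichotomy j p with hjp | rfl | hjp
    · have h1 : j + 1 ≤ p := by omega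
      simpa [h1, hjp.le] using h.passes j (by omega)
    · obtain ⟨d, rfl⟩ : ∃ d', d = d' + 1 := ⟨d - 1, by omega⟩
      have hw := h.walk (p := j + 1) d (by omega)
      rw [show j + 1 + d + 1 = j + 1 + (d + 1) by omega, ← hx] at hw
      have h2 := h.passes (j + 1 + d) (by omega)
      rw [show j + 1 + d + 1 = j + 1 + (d + 1) by omega, ← hx] at h2
      simpa using hR.passes_of_closed_walk hG (h.passes j (by omega)) hw h2
    · have h1 : ¬ j ≤ p := by omega
      have h2 : ¬ j + 1 ≤ p := by omega
      simpa [h1, h2, show j + 1 + d = j + d + 1 by omega] using h.passes (j + d) (by omega)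

/-- A shortest walk between two nodes has distinct inner nodes. -/
theorem exists_isWalkSeq_injOn (hG : G.IsSummaryGraph) {R T : Set V} (hR : G.IsAncestral R)
    {i k : V} {a b : Bool} (h : Walk G.MarkedEdge R T i a k b) :
    ∃ n x e, G.IsWalkSeq R T n x e ∧ x 0 = i ∧ x (n + 1) = k ∧
      Set.InjOn x (Set.Ioo 0 (n + 1)) := by
  classical
  -- Length is minimised regardless of the end marks, since a cut could alter nothing else that
  -- matters for independence.
  have hex : ∃ n, ∃ x e, G.IsWalkSeq R T n x e ∧ x 0 = i ∧ x (n + 1) = k := by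
    obtain ⟨n, x, e, h, h0, hn, -⟩ := h.exists_isWalkSeq
    exact ⟨n, x, e, h, h0, hn⟩
  obtain ⟨x, e, hseq, h0, hn⟩ := Nat.find_spec hex
  refine ⟨_, x, e, hseq, h0, hn, ?_⟩
  have key : ∀ p q, 0 < p → p < q → q < Nat.find hex + 1 → x p ≠ x q := by
    intro p q hp hpq hq heq
    obtain ⟨p, rfl⟩ : ∃ p', p = p' + 1 := ⟨p - 1, by omega⟩
    obtain ⟨d, rfl⟩ : ∃ d, q = p + 1 + d := ⟨q - (p + 1), by omega⟩
    refine Nat.find_min hex (m := Nat.find hex - d) (by omega)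
      ⟨_, _, hseq.cut hG hR (by omega) (by omega) heq, by simpa using h0, ?_⟩
    have h1 : ¬ Nat.find hex - d + 1 ≤ p + 1 := by omega
    simp only [h1, if_false]
    refine Eq.trans ?_ hn
    congr 1
    omega
  intro p hp q hq heq
  rcases Nat.lt_trichotomy p q with h | h | h
  · exact absurd heq (key p q hp.1 h hq.2)
  · exact h
  · exact absurd heq.symm (key q p hq.1 h hp.2)

/-- The independence structure in terms of walks. -/
theorem implies_iff (hG : G.IsSummaryGraph) (α β c : Set V) :
    G.Implies α β c ↔ ∀ i ∈ α, ∀ k ∈ β, ∀ a b,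
      ¬ Walk G.MarkedEdge (G.condClosure c) (G.nodes \ c) i a k b := by
  constructor
  · intro h i hi k hk a b hw
    refine h ⟨i, hi, k, hk, ?_⟩
    obtain ⟨n, x, e, hseq, h0, hn, hinj⟩ :=
      exists_isWalkSeq_injOn hG (isAncestral_condClosure hG c) hw
    refine ⟨n + 1, x, e, ⟨by omega, ?_, hinj, ?_, ?_⟩, h0, hn⟩
    · exact fun j hj => (hasEdge_iff _ _ _).2 (hseq.edge j (by omega))
    · intro j hj hc
      rw [isCollision_iff] at hc
      have he := hseq.edge j (by omega)
      rw [hc.1] at he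
      have hu := hG.mem_u_of_head he
      rcases hseq.passes j (by omega) with ⟨-, -, (h | h) | h⟩ | ⟨h, -⟩
      -- Including `v` in the collision set opens no new collision, because no head or dashed end
      -- lies in `v`.
      · exact absurd h (hG.disjoint.notMem_of_mem_left hu)
      · exact Or.inl h
      · exact Or.inr h
      · simp [hc] at h
    · intro j hj hc
      rw [isCollision_iff] at hc
      rcases hseq.passes j (by omega) with ⟨h1, h2, -⟩ | ⟨-, h⟩
      exacts [absurd ⟨h1, h2⟩ hc, h.2]
  · rintro h ⟨i, hi, k, hk, n, x, e, hpath, rfl, rfl⟩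
    obtain ⟨n, rfl⟩ : ∃ n', n = n' + 1 := ⟨n - 1, by have := hpath.pos; omega⟩
    have hedge : ∀ j ≤ n, G.MarkedEdge (x j) (e j).leftMark (x (j + 1)) (e j).rightMark :=
      fun j hj => (hasEdge_iff _ _ _).1 (hpath.edge j (by omega))
    have hseq : G.IsWalkSeq (G.condClosure c) (G.nodes \ c) n x e := by
      refine ⟨hedge, ?_⟩
      intro j hj
      by_cases hc : IsCollision (e j) (e (j + 1))
      · obtain ⟨h1, h2⟩ := (isCollision_iff _ _).1 hc
        refine Or.inl ⟨h1, h2, ?_⟩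
        rcases hpath.collision j (by omega) hc with h | h
        exacts [Or.inl (Or.inr h), Or.inr h]
      · refine Or.inr ⟨?_, hG.mem_nodes_right (hedge j hj.le),
          hpath.transmitting j (by omega) hc⟩
        rw [isCollision_iff, not_and_or] at hc
        simpa using hc
    have hw := hseq.walk (p := 0) n (by omega)
    simp only [Nat.zero_add] at hw
    exact h _ hi _ hk _ _ hw

/-- The reduced graph preserves the independence structure. -/
theorem preservesIndependence_reduce (hG : G.IsSummaryGraph) {S T : Set V} (hS : S ⊆ G.nodes)
    (hT : T ⊆ G.nodes) (hST : Disjoint S T) : G.PreservesIndependence S (G.reduce S T) := by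
  intro α β c hα hβ hc hαβ _ _
  have hN := nodes_reduce hG (S := S) (T := T) hS
  rw [hN] at hα hβ hc
  have hcT : Disjoint c T := Set.disjoint_left.2 fun x hx hx' => (hc hx).2 (Or.inr hx')
  rw [implies_iff (isSummaryGraph_reduce hG), implies_iff hG, hN]
  -- Transmission through everything outside `c` in the reduced graph, together with `T`, is
  -- transmission through everything outside `S ∪ c` in `G`.
  have hset : T ∪ (G.nodes \ (S ∪ T)) \ c = G.nodes \ (S ∪ c) := by
    ext x
    simp only [Set.mem_union, Set.mem_sdiff, not_or]
    constructor
    · rintro (h | h)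
      · exact ⟨hT h, hST.notMem_of_mem_right h, hcT.notMem_of_mem_right h⟩
      · tauto
    · tauto
  rw [Set.union_comm c S, ← hset]
  refine forall₂_congr fun i hi => forall₂_congr fun k hk => ?_
  constructor
  · intro h a b hw
    obtain ⟨a', b', hw', -, -⟩ := exists_walk_reduce_of_walk hG hS hcT
      (Set.disjoint_left.2 fun x hx hx' => hx.1.2 (Or.inl hx')) (hα hi) (hβ hk)
      (fun e => hαβ.notMem_of_mem_left hi (e ▸ hk)) hw
    exact h _ _ hw'
  · intro h a b hw
    obtain ⟨a', b', hw', -, -⟩ := exists_walk_of_walk_reduce hG hS hcT hw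
    exact h _ _ hw'

end MixedGraph

/-! ### The matrix formulas of a directed acyclic graph. -/

namespace MixedGraph

variable {V : Type*} {D : MixedGraph V}

theorem DirectedWalk.cons {T : Set V} {i j k : V} (h : D.DirectedWalk T j k) (hj : j ∈ T)
    (he : D.arrow j i) : D.DirectedWalk T i k := by
  induction h with
  | edge he' => exact .step (.edge he) hj he'
  | step _ hl he' ih => exact .step ih hl he'

theorem DirectedWalk.mono {T T' : Set V} {i k : V} (h : D.DirectedWalk T i k) (hT : T ⊆ T') :
    D.DirectedWalk T' i k := by
  induction h with
  | edge he => exact .edge he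
  | step _ hl he ih => exact .step ih (hT hl) he

/-- The partial closure of the edge matrix of a directed acyclic graph describes directed walks. -/
theorem zer_edgeMatrix_iff {p : Set V} {i k : V} (hi : i ∉ p) (hne : i ≠ k) :
    zer p D.edgeMatrix i k ↔ D.DirectedWalk p k i := by
  have arrow_of : ∀ {j}, j ∈ p → D.edgeMatrix i j → D.arrow i j := fun hj h =>
    h.resolve_left fun e => hi (e ▸ hj)
  have walk_of_closure : ∀ {j l}, D.arrow i j → closure p D.edgeMatrix j l →
      D.DirectedWalk p l i := by
    rintro j l he ⟨hj, -, h⟩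
    have key : l = j ∨ D.DirectedWalk p l j := by
      clear he
      induction h using Relation.ReflTransGen.head_induction_on with
      | refl => exact Or.inl rfl
      | head h _ ih =>
        obtain ⟨h1, h2, rfl | h3⟩ := h
        · exact ih h2
        · right
          rcases ih h2 with rfl | ih
          exacts [.edge h3, .step ih h2 h3]
    rcases key with rfl | h
    exacts [.edge he, .step h hj he]
  constructor
  · rintro (⟨h, -, -⟩ | ⟨h, -, -⟩ | ⟨-, hk, j, hj, hc⟩ | ⟨-, hk, h | ⟨j, l, hj, hc, hl⟩⟩)
    · exact absurd h hi
    · exact absurd h hi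
    · exact walk_of_closure (arrow_of hc.1 hj) hc
    · exact .edge (h.resolve_left hne)
    · exact (walk_of_closure (arrow_of hc.1 hj) hc).cons hc.2.1
        (hl.resolve_left fun e => hk (e ▸ hc.2.1))
  · intro h
    have key : ∀ {j}, D.DirectedWalk p k j → j ∈ p → (k ∈ p → closure p D.edgeMatrix j k) ∧
        (k ∉ p → ∃ l, closure p D.edgeMatrix j l ∧ D.edgeMatrix l k) := by
      intro j h
      induction h with
      | @edge j he =>
        intro hj
        exact ⟨fun hk => ⟨hj, hk, .single ⟨hj, hk, Or.inr he⟩⟩,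
          fun _ => ⟨j, ⟨hj, hj, .refl⟩, Or.inr he⟩⟩
      | @step j j' _ hj he ih =>
        intro hj'
        refine ⟨fun hk => ⟨hj', hk, .head ⟨hj', hj, Or.inr he⟩ ((ih hj).1 hk).2.2⟩, fun hk => ?_⟩
        obtain ⟨l, hl, hl'⟩ := (ih hj).2 hk
        exact ⟨l, ⟨hj', hl.2.1, .head ⟨hj', hj, Or.inr he⟩ hl.2.2⟩, hl'⟩
    cases h with
    | edge he =>
      by_cases hk : k ∈ p
      · exact Or.inr (Or.inr (Or.inl ⟨hi, hk, k, Or.inr he, hk, hk, .refl⟩))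
      · exact Or.inr (Or.inr (Or.inr ⟨hi, hk, Or.inl (Or.inr he)⟩))
    | @step j _ h hj he =>
      by_cases hk : k ∈ p
      · exact Or.inr (Or.inr (Or.inl ⟨hi, hk, j, Or.inr he, (key h hj).1 hk⟩))
      · obtain ⟨l, hl, hl'⟩ := (key h hj).2 hk
        exact Or.inr (Or.inr (Or.inr ⟨hi, hk, Or.inr ⟨j, l, Or.inr he, hl, hl'⟩⟩))

/-- The partial closure of a matrix with unit diagonal, in terms of chains of ones through `q`. -/
theorem zer_iff_chain {q : Set V} {S : V → V → Prop} {j k : V}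
    (hk : S k k) : zer q S j k ↔
      ∃ l, Relation.ReflTransGen (fun x y => y ∈ q ∧ S x y) j l ∧ S l k := by
  have chain_of : ∀ {x l}, closure q S x l →
      Relation.ReflTransGen (fun x y => y ∈ q ∧ S x y) x l := by
    rintro x l ⟨-, -, h⟩
    exact Relation.ReflTransGen.mono (fun _ _ h => h.2) _ _ h
  have closure_of : ∀ {x l}, x ∈ q → Relation.ReflTransGen (fun x y => y ∈ q ∧ S x y) x l →
      closure q S x l := by
    intro x l hx h
    induction h with
    | refl => exact ⟨hx, hx, .refl⟩
    | tail _ h ih => exact ⟨hx, h.1, ih.2.2.tail ⟨ih.2.1, h⟩⟩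
  constructor
  · rintro (⟨-, -, h⟩ | ⟨-, -, l, h, h'⟩ | ⟨-, hk', l, h, h'⟩ | ⟨-, -, h | ⟨x, l, h, h', h''⟩⟩)
    · exact ⟨k, chain_of h, hk⟩
    · exact ⟨l, chain_of h, h'⟩
    · exact ⟨k, .head ⟨h'.1, h⟩ (chain_of h'), hk⟩
    · exact ⟨j, .refl, h⟩
    · exact ⟨l, .head ⟨h'.1, h⟩ (chain_of h'), h''⟩
  · rintro ⟨l, h, h'⟩
    by_cases hjq : j ∈ q
    · by_cases hkq : k ∈ q
      · exact Or.inl ⟨hjq, hkq, closure_of hjq (h.tail ⟨hkq, h'⟩)⟩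
      · exact Or.inr (Or.inl ⟨hjq, hkq, l, closure_of hjq h, h'⟩)
    · by_cases hkq : k ∈ q
      · refine Or.inr (Or.inr (Or.inl ⟨hjq, hkq, ?_⟩))
        rcases Relation.ReflTransGen.cases_head h with rfl | ⟨x, ⟨hx, hx'⟩, h⟩
        · exact ⟨k, h', hkq, hkq, .refl⟩
        · exact ⟨x, hx', closure_of hx (h.tail ⟨hkq, h'⟩)⟩
      · refine Or.inr (Or.inr (Or.inr ⟨hjq, hkq, ?_⟩))
        rcases Relation.ReflTransGen.cases_head h with rfl | ⟨x, ⟨hx, hx'⟩, h⟩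
        · exact Or.inl h'
        · exact Or.inr ⟨x, l, hx', closure_of hx h, h'⟩

namespace IsDAG

theorem markedEdge_cases (hD : D.IsDAG) {i k : V} {a b : Bool} (h : D.MarkedEdge i a k b) :
    (a = true ∧ b = false ∧ D.arrow i k) ∨ (a = false ∧ b = true ∧ D.arrow k i) := by
  cases a <;> cases b
  · exact absurd h (hD.no_full i k)
  · exact Or.inr ⟨rfl, rfl, h⟩
  · exact Or.inl ⟨rfl, rfl, h⟩
  · exact absurd h (hD.no_dashed i k)

theorem mem_foster_iff (hD : D.IsDAG) {C : Set V} {x : V} :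
    x ∈ D.foster C ↔ x ∈ D.condClosure C ∧ x ∉ C := by
  simp only [foster, condClosure, hD.v_empty, Set.empty_union, Set.mem_sdiff, Set.mem_union]
  tauto

theorem union_foster (hD : D.IsDAG) (C : Set V) : C ∪ D.foster C = D.condClosure C := by
  simp [foster, condClosure, hD.v_empty]

theorem outsiders_eq (hD : D.IsDAG) (C : Set V) :
    D.outsiders C = D.nodes \ D.condClosure C := by
  rw [outsiders, hD.union_foster]

theorem fosterMatrix_self {C : Set V} {x : V} (hx : x ∈ D.foster C) : D.fosterMatrix C x x :=
  ⟨hx, hx, x, Or.inr hx, Or.inl rfl, Or.inl rfl⟩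

/-- At marginalised foster nodes walks can be glued without regard to marks; this is why the matrix
products need not record them. -/
theorem passes_foster (hD : D.IsDAG) {C M : Set V} {x : V} (hx : x ∈ D.foster C ∩ M)
    (m m' : Bool) : Passes (D.condClosure C) M m x m' := by
  have := (hD.mem_foster_iff.1 hx.1).1
  cases m <;> cases m' <;> simp [Passes, this, hx.2]

/-- Walks between foster nodes are chains of ones of the foster matrix. -/
theorem zer_fosterMatrix_of_walk (hD : D.IsDAG) {C M : Set V} (hCM : Disjoint C M) {j k : V}
    {a b : Bool} (hj : j ∈ D.foster C) (hk : k ∈ D.foster C)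
    (h : Walk D.MarkedEdge (D.condClosure C) M j a k b) :
    zer (D.foster C ∩ M) (D.fosterMatrix C) j k := by
  have hR := isAncestral_condClosure hD.isSummaryGraph C
  have hF : ∀ {x}, x ∈ D.condClosure C → x ∈ M → x ∈ D.foster C ∩ M := fun hx hM =>
    ⟨hD.mem_foster_iff.2 ⟨hx, hCM.notMem_of_mem_right hM⟩, hM⟩
  let Chain := Relation.ReflTransGen (fun x y => y ∈ D.foster C ∩ M ∧ D.fosterMatrix C x y) j
  have hchain : ∀ {l}, Chain l → l ∈ D.foster C := by
    intro l h
    rcases Relation.ReflTransGen.cases_tail h with rfl | ⟨_, _, h⟩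
    exacts [hj, h.1.1]
  have hCR : ∀ {x}, x ∈ D.condClosure C ↔ x ∈ C ∪ D.foster C := by simp [hD.union_foster]
  -- Either the walk has left the closure, which it cannot re-enter, or it hangs on the last chain
  -- node `l` by at most one collision `r`. Two collisions are never adjacent on arrows alone, so
  -- every transmission at a foster node completes a one of the foster matrix.
  have key : (k ∉ D.condClosure C ∧ b = true) ∨ (k ∈ D.condClosure C ∧ ∃ l, Chain l ∧
      ((b = false ∧ ∃ r ∈ D.condClosure C, D.edgeMatrix r l ∧ D.arrow r k) ∨
        (b = true ∧ D.arrow k l))) := by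
    clear hk
    have hjR := (hD.mem_foster_iff.1 hj).1
    have leave : ∀ {l k b c}, Chain l → l ∈ D.condClosure C → D.MarkedEdge l b k c →
        (k ∉ D.condClosure C ∧ c = true) ∨ (k ∈ D.condClosure C ∧ ∃ l, Chain l ∧
      ((c = false ∧ ∃ r ∈ D.condClosure C, D.edgeMatrix r l ∧ D.arrow r k) ∨
        (c = true ∧ D.arrow k l))) := by
      intro l k b c hl hlR he
      rcases hD.markedEdge_cases he with ⟨-, hc, he⟩ | ⟨-, hc, he⟩
      · exact Or.inr ⟨hR.parent_mem _ _ he hlR, l, hl, Or.inl ⟨hc, l, hlR, Or.inl rfl, he⟩⟩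
      · by_cases hk : k ∈ D.condClosure C
        · exact Or.inr ⟨hk, l, hl, Or.inr ⟨hc, he⟩⟩
        · exact Or.inl ⟨hk, hc⟩
    induction h with
    | edge he => exact leave .refl hjR he
    | @step x k b b' c _ hp he ih =>
      rcases ih with ⟨hx, rfl⟩ | ⟨hx, l, hl, h⟩
      · rcases hp with ⟨-, -, h⟩ | ⟨h, hM⟩
        · exact absurd h hx
        · obtain rfl : b' = false := by simpa using h
          rcases hD.markedEdge_cases he with ⟨h, -⟩ | ⟨-, hc, he⟩
          · cases h
          · exact Or.inl ⟨fun h => hx (hR.parent_mem _ _ he h), hc⟩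
      · have hlF := hchain hl
        rcases hp with ⟨rfl, rfl, -⟩ | ⟨-, hM⟩
        · have hxl : D.arrow x l := by simpa using h
          rcases hD.markedEdge_cases he with ⟨-, hc, he⟩ | ⟨h, -⟩
          · exact Or.inr ⟨hR.parent_mem _ _ he hx, l, hl, Or.inl ⟨hc, x, hx, Or.inr hxl, he⟩⟩
          · cases h
        · have hxq := hF hx hM
          refine leave (hl.tail ⟨hxq, hlF, hxq.1, ?_⟩) hx he
          rcases h with ⟨-, r, hr, h1, h2⟩ | ⟨-, h⟩
          · exact ⟨r, hCR.1 hr, h1, Or.inr h2⟩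
          · exact ⟨x, hCR.1 hx, Or.inr h, Or.inl rfl⟩
  rw [zer_iff_chain (fosterMatrix_self hk)]
  rcases key with ⟨h, -⟩ | ⟨h, l, hl, h'⟩
  · exact absurd (hD.mem_foster_iff.1 hk).1 h
  · refine ⟨l, hl, hchain hl, hk, ?_⟩
    rcases h' with ⟨-, r, hr, h1, h2⟩ | ⟨-, h'⟩
    · exact ⟨r, hCR.1 hr, h1, Or.inr h2⟩
    · exact ⟨k, Or.inr hk, Or.inr h', Or.inl rfl⟩

theorem walk_of_fosterMatrix (hD : D.IsDAG) {C M : Set V} {j k : V} (hne : j ≠ k)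
    (h : D.fosterMatrix C j k) :
    ∃ a b, Walk D.MarkedEdge (D.condClosure C) M j a k b := by
  obtain ⟨-, -, r, hr, rfl | h1, h2⟩ := h
  · exact ⟨true, false, .edge (h2.resolve_left hne)⟩
  · rcases h2 with rfl | h2
    · exact ⟨false, true, .edge h1⟩
    · rw [hD.union_foster] at hr
      exact ⟨false, false, .step (b := true) (b' := true) (.edge h1) (Or.inl ⟨rfl, rfl, hr⟩) h2⟩

theorem walk_of_zer_fosterMatrix (hD : D.IsDAG) {C M : Set V} {j k : V}
    (hk : k ∈ D.foster C) (hne : j ≠ k)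
    (h : zer (D.foster C ∩ M) (D.fosterMatrix C) j k) :
    ∃ a b, Walk D.MarkedEdge (D.condClosure C) M j a k b := by
  rw [zer_iff_chain (fosterMatrix_self hk)] at h
  obtain ⟨l, hl, h⟩ := h
  have append : ∀ {l k}, (l = j ∨ (l ∈ D.foster C ∩ M ∧
      ∃ a b, Walk D.MarkedEdge (D.condClosure C) M j a l b)) → D.fosterMatrix C l k →
      k = j ∨ ∃ a b, Walk D.MarkedEdge (D.condClosure C) M j a k b := by
    intro l k hl h
    by_cases hlk : l = k
    · subst hlk
      exact hl.imp id (·.2)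
    · obtain ⟨a', b', h⟩ := hD.walk_of_fosterMatrix (M := M) hlk h
      rcases hl with rfl | ⟨hl, a, b, h'⟩
      · exact Or.inr ⟨a', b', h⟩
      · exact Or.inr ⟨a, b', h'.trans (hD.passes_foster hl _ _) h⟩
  refine (append ?_ h).resolve_left hne.symm
  clear h hk hne
  induction hl with
  | refl => exact Or.inl rfl
  | tail _ h ih => exact (append ih h.2).imp id fun hw => ⟨h.1, hw⟩

/-- The shapes of the walks that start outside the conditioning nodes and their ancestors. -/
theorem walk_cases (hD : D.IsDAG) {C M : Set V} (hCM : Disjoint C M) {i k : V} {a b : Bool}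
    (hi : i ∉ D.condClosure C) (h : Walk D.MarkedEdge (D.condClosure C) M i a k b) :
    (b = false ∧ D.DirectedWalk (D.outsiders C ∩ M) k i) ∨
    (∃ j ∈ D.foster C ∩ M, D.DirectedWalk (D.outsiders C ∩ M) j i ∧
      ∃ a', Walk D.MarkedEdge (D.condClosure C) M j a' k b) ∨
    (k ∉ D.condClosure C ∧ b = true ∧ (a = false ∨ ∃ t ∈ D.outsiders C ∩ M,
      D.DirectedWalk (D.outsiders C ∩ M) t i ∧ D.DirectedWalk (D.outsiders C ∩ M) t k)) := by
  have hR := isAncestral_condClosure hD.isSummaryGraph C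
  induction h with
  | edge he =>
    rcases hD.markedEdge_cases he with ⟨-, hc, he⟩ | ⟨ha, hc, he⟩
    · exact Or.inl ⟨hc, .edge he⟩
    · exact Or.inr (Or.inr ⟨fun h => hi (hR.parent_mem _ _ he h), hc, Or.inl ha⟩)
  | @step x k b b' c hw hp he ih =>
    have hxO : x ∉ D.condClosure C → x ∈ M → x ∈ D.outsiders C ∩ M := fun hx hM =>
      ⟨hD.outsiders_eq C ▸ ⟨hD.isSummaryGraph.walk_mem_nodes hw, hx⟩, hM⟩
    -- The walk climbs against the arrows until it meets a marginalised foster node or turns at a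
    -- source `t`; after turning outside the closure it can only descend.
    rcases ih with ⟨rfl, hd⟩ | ⟨j, hj, hd, a', h⟩ | ⟨hx, rfl, h⟩
    · have hM : x ∈ M := by simpa [Passes] using hp
      by_cases hx : x ∈ D.condClosure C
      · exact Or.inr (Or.inl ⟨x, ⟨hD.mem_foster_iff.2 ⟨hx, hCM.notMem_of_mem_right hM⟩, hM⟩, hd,
          b', .edge he⟩)
      · rcases hD.markedEdge_cases he with ⟨-, hc, he⟩ | ⟨-, hc, he⟩
        · exact Or.inl ⟨hc, hd.cons (hxO hx hM) he⟩
        · exact Or.inr (Or.inr ⟨fun h => hx (hR.parent_mem _ _ he h), hc,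
            Or.inr ⟨x, hxO hx hM, hd, .edge he⟩⟩)
    · exact Or.inr (Or.inl ⟨j, hj, hd, a', .step h hp he⟩)
    · rcases hp with ⟨-, -, h⟩ | ⟨h', hM⟩
      · exact absurd h hx
      obtain rfl : b' = false := by simpa using h'
      rcases hD.markedEdge_cases he with ⟨h, -⟩ | ⟨-, hc, he⟩
      · cases h
      refine Or.inr (Or.inr ⟨fun h => hx (hR.parent_mem _ _ he h), hc, h.imp id ?_⟩)
      rintro ⟨t, ht, h1, h2⟩
      exact ⟨t, ht, h1, h2.step (hxO hx hM) he⟩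

/-- The summary graph of a directed acyclic graph is its reduction. -/
theorem summaryGraph_eq_reduce (hD : D.IsDAG) {C M : Set V} (hCM : Disjoint C M) :
    D.summaryGraph C M = D.reduce C M := by
  have hG := hD.isSummaryGraph
  have hu : D.outsiders C \ M = D.nodes \ (C ∪ M ∪ D.condClosure C) := by
    have : C ⊆ D.condClosure C := fun x hx => Or.inl (Or.inr hx)
    ext x
    have := @this x
    simp only [hD.outsiders_eq, Set.mem_sdiff, Set.mem_union]
    tauto
  have hv : D.foster C \ M = D.condClosure C \ (C ∪ M) := by
    ext x
    simp only [Set.mem_sdiff, hD.mem_foster_iff, Set.mem_union]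
    tauto
  have hO : ∀ {x}, x ∈ D.outsiders C → x ∉ D.condClosure C := by
    intro x hx
    rw [hD.outsiders_eq] at hx
    exact hx.2
  have hF : ∀ {x}, x ∈ D.foster C → x ∈ D.condClosure C := fun hx => (hD.mem_foster_iff.1 hx).1
  have up : ∀ {i j}, D.DirectedWalk (D.outsiders C ∩ M) j i →
      Walk D.MarkedEdge (D.condClosure C) M i true j false := fun h =>
    hG.walk_symm ((h.mono Set.inter_subset_right).walk _)
  have zerD : ∀ {i j}, i ∈ D.outsiders C \ M → i ≠ j →
      (zer (D.outsiders C ∩ M) D.edgeMatrix i j ↔ D.DirectedWalk (D.outsiders C ∩ M) j i) :=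
    fun hi hne => zer_edgeMatrix_iff (fun h => hi.2 h.2) hne
  have neM : ∀ {i j : V} {A : Set V}, i ∈ A \ M → j ∈ M → i ≠ j := fun hi hj e => hi.2 (e ▸ hj)
  have neF : ∀ {i j}, i ∈ D.outsiders C → j ∈ D.foster C → i ≠ j := fun hi hj e =>
    hO hi (hF (e ▸ hj))
  apply MixedGraph.ext
  · exact hu
  · exact hv
  · funext i k
    simp only [summaryGraph, reduce, ← hu, ← hv, eq_iff_iff]
    constructor
    · rintro (⟨hi, hk, hne, h⟩ | ⟨hi, hk, h⟩)
      · exact ⟨hne, hi, Or.inl ⟨hk, up ((zerD hi hne).1 h)⟩⟩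
      · have hne := neF hi.1 hk.1
        refine ⟨hne, hi, Or.inr ⟨hk, ?_⟩⟩
        rcases h with h | ⟨j, hj, h, h'⟩
        · exact ⟨_, _, up ((zerD hi hne).1 h)⟩
        · obtain ⟨a, b, h'⟩ := hD.walk_of_zer_fosterMatrix hk.1 (neM hk hj.2).symm h'
          exact ⟨_, _, (up ((zerD hi (neM hi hj.2)).1 h)).trans (hD.passes_foster hj _ _) h'⟩
    · rintro ⟨hne, hi, ⟨hk, h⟩ | ⟨hk, a, b, h⟩⟩
      · refine Or.inl ⟨hi, hk, hne, (zerD hi hne).2 ?_⟩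
        rcases hD.walk_cases hCM (hO hi.1) h with ⟨-, h⟩ | ⟨j, hj, -, a', h⟩ | ⟨-, h, -⟩
        · exact h
        -- A tail at `k` would make the reversed walk directed and `k` an ancestor of the foster
        -- node `j`.
        · have := (isAncestral_condClosure hG C).directedWalk hG (hG.walk_symm h) (hO hk.1)
          exact absurd ((isAncestral_condClosure hG C).ancestor_mem this.2.isAncestor (hF hj.1))
            (hO hk.1)
        · cases h
      · refine Or.inr ⟨hi, hk, ?_⟩
        rcases hD.walk_cases hCM (hO hi.1) h with ⟨-, h⟩ | ⟨j, hj, h', a', h⟩ | ⟨h, -, -⟩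
        · exact Or.inl ((zerD hi hne).2 h)
        · exact Or.inr ⟨j, hj, (zerD hi (neM hi hj.2)).2 h',
            hD.zer_fosterMatrix_of_walk hCM hj.1 hk.1 h⟩
        · exact absurd (hF hk.1) h
  · funext i k
    simp only [summaryGraph, reduce, ← hu, eq_iff_iff]
    constructor
    · rintro ⟨hi, hk, hne, ⟨j, hj, h, h'⟩ | ⟨j, hj, l, hl, h, h', h''⟩⟩
      · have h := up ((zerD hi (neM hi hj.2)).1 h)
        have h' := up ((zerD hk (neM hk hj.2)).1 h')
        exact ⟨hne, hi, hk, h.trans (Or.inr ⟨Or.inl rfl, hj.2⟩) (hG.walk_symm h')⟩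
      · have h := up ((zerD hi (neM hi hj.2)).1 h)
        have h'' := hG.walk_symm (up ((zerD hk (neM hk hl.2)).1 h''))
        refine ⟨hne, hi, hk, ?_⟩
        by_cases hjl : j = l
        · subst hjl
          exact h.trans (hD.passes_foster hj _ _) h''
        · obtain ⟨a, b, h'⟩ := hD.walk_of_zer_fosterMatrix hl.1 hjl h'
          exact (h.trans (hD.passes_foster hj _ _) h').trans (hD.passes_foster hl _ _) h''
    · rintro ⟨hne, hi, hk, h⟩
      refine ⟨hi, hk, hne, ?_⟩
      rcases hD.walk_cases hCM (hO hi.1) h with ⟨h, -⟩ | ⟨j, hj, hd, a', h⟩ |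
        ⟨-, -, h | ⟨t, ht, h, h'⟩⟩
      · cases h
      · have hzi := (zerD hi (neM hi hj.2)).2 hd
        rcases hD.walk_cases hCM (hO hk.1) (hG.walk_symm h) with ⟨-, h⟩ | ⟨l, hl, hd', a, h⟩ |
          ⟨h, -⟩
        -- Both ends climb to the same foster node; the unit diagonal of the foster matrix supplies
        -- the middle factor.
        · refine Or.inr ⟨j, hj, j, hj, hzi, ?_, (zerD hk (neM hk hj.2)).2 h⟩
          exact (zer_iff_chain (fosterMatrix_self hj.1)).2
            ⟨j, .refl, fosterMatrix_self hj.1⟩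
        · exact Or.inr ⟨j, hj, l, hl, hzi,
            hD.zer_fosterMatrix_of_walk hCM hj.1 hl.1 (hG.walk_symm h),
            (zerD hk (neM hk hl.2)).2 hd'⟩
        · exact absurd (hF hj.1) h
      · cases h
      · exact Or.inl ⟨t, ht, (zerD hi (neM hi ht.2)).2 h, (zerD hk (neM hk ht.2)).2 h'⟩
  · funext i k
    simp only [summaryGraph, reduce, ← hv, eq_iff_iff]
    constructor
    · rintro ⟨hi, hk, hne, h⟩
      exact ⟨hne, hi, hk, hD.walk_of_zer_fosterMatrix hk.1 hne h⟩
    · rintro ⟨hne, hi, hk, a, b, h⟩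
      exact ⟨hi, hk, hne, hD.zer_fosterMatrix_of_walk hCM hi.1 hk.1 h⟩

end IsDAG

end MixedGraph

/-! ### Assembly: generating graphs and lists of operations. -/

namespace MixedGraph

variable {V : Type*} {G : MixedGraph V}

/-- With nothing to condition on, collisions are open only in `v`, where none occurs, and forgetting
marks in `v` changes nothing. This starts the induction over lists. -/
theorem reduce_empty (hG : G.IsSummaryGraph) : G.reduce ∅ ∅ = G := by
  have hcl : G.condClosure ∅ = G.v := by
    ext x; simp [condClosure, ancestors]
  have hwalk : ∀ {i a k b}, Walk G.MarkedEdge (G.condClosure ∅) ∅ i a k b ↔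
      G.MarkedEdge i a k b := by
    refine ⟨fun h => ?_, .edge⟩
    have := walk_condClosure hG (Set.disjoint_empty ∅) h
    exact (this.mono (by simp [ancestors]) subset_rfl).edge_of_empty
  have hseen : ∀ {i k a b}, G.MarkedEdge i a k b → Seen G.v i a a := by
    intro i k a b h
    by_cases hi : i ∈ G.v
    · cases a
      · exact Or.inl ⟨hi, rfl⟩
      · exact absurd hi (hG.disjoint.notMem_of_mem_left
          (hG.mem_u_of_head (hG.markedEdge_symm _ _ _ _ h)))
    · exact Or.inr ⟨hi, rfl⟩
  have hfun : ∀ {R : Set V} {x m m₁ m₂}, Seen R x m m₁ → Seen R x m m₂ → m₁ = m₂ := by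
    rintro R x m m₁ m₂ (⟨h, rfl⟩ | ⟨h, rfl⟩) (⟨h', rfl⟩ | ⟨h', rfl⟩)
    exacts [rfl, absurd h h', absurd h' h, rfl]
  apply ext_markedEdge
  · ext x
    have := fun h => hG.disjoint.notMem_of_mem_left (a := x) h
    simp only [reduce, hcl, nodes, Set.mem_sdiff, Set.mem_union, Set.mem_empty_iff_false]
    tauto
  · simp [reduce, hcl]
  · intro i a k b
    rw [markedEdge_reduce hG (Set.empty_subset _), hcl]
    rw [hcl] at hwalk
    constructor
    · rintro ⟨-, -, -, a₀, b₀, h, ha, hb⟩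
      have h := hwalk.1 h
      obtain rfl := hfun ha (hseen h)
      obtain rfl := hfun hb (hseen (hG.markedEdge_symm _ _ _ _ h))
      exact h
    · intro h
      have hs := hG.markedEdge_symm _ _ _ _ h
      exact ⟨hG.markedEdge_ne h, by simpa using hG.mem_nodes_right hs,
        by simpa using hG.mem_nodes_right h, a, b, hwalk.2 h, hseen h, hseen hs⟩

/-- The reduced graph is the independence-preserving summary graph. -/
theorem isSummaryGraphAfter_reduce (hG : G.IsSummaryGraph) {S T : Set V} (hS : S ⊆ G.nodes)
    (hT : T ⊆ G.nodes) (hST : Disjoint S T) : G.IsSummaryGraphAfter S T (G.reduce S T) where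
  isSummaryGraph := isSummaryGraph_reduce hG
  nodes_eq := nodes_reduce hG hS
  v_eq := (newV_eq hG S T).symm
  preserves := preservesIndependence_reduce hG hS hT hST
  generated := by
    intro D C M hD hC hM hCM h
    have hD' := hD.isSummaryGraph
    rw [hD.summaryGraph_eq_reduce hCM] at h
    subst h
    have hN := nodes_reduce hD' (S := C) (T := M) hC
    have hS' := hN ▸ hS
    have hT' := hN ▸ hT
    have hCS : C ∪ S ⊆ D.nodes := Set.union_subset hC fun x hx => (hS' hx).1
    have hMT : M ∪ T ⊆ D.nodes := Set.union_subset hM fun x hx => (hT' hx).1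
    have hdisj : Disjoint (C ∪ S) (M ∪ T) := by
      rw [Set.disjoint_union_left, Set.disjoint_union_right, Set.disjoint_union_right]
      exact ⟨⟨hCM, Set.disjoint_left.2 fun x hx hx' => (hT' hx').2 (Or.inl hx)⟩,
        Set.disjoint_left.2 fun x hx hx' => (hS' hx).2 (Or.inr hx'), hST⟩
    rw [reduce_reduce hD' hC hS hT, hD.summaryGraph_eq_reduce hdisj]
    exact ⟨rfl, preservesIndependence_reduce hD' hCS hMT hdisj⟩

theorem disjoint_condSet_margSet {ops : List (Op V)} (h : (ops.map Op.node).Nodup) :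
    Disjoint (condSet ops) (margSet ops) := by
  refine Set.disjoint_left.2 fun x hx hx' => ?_
  have := List.inj_on_of_nodup_map h hx hx' rfl
  cases this

variable [Finite V]

/-- Operating on one node at a time yields the reduced graph. -/
theorem generatesList_iff (hG : G.IsSummaryGraph) {ops : List (Op V)}
    (hnd : (ops.map Op.node).Nodup) (hops : ∀ o ∈ ops, o.node ∈ G.nodes) {H : MixedGraph V} :
    GeneratesList G ops H ↔ H = G.reduce (condSet ops) (margSet ops) := by
  induction ops generalizing G with
  | nil =>
    have h1 : condSet ([] : List (Op V)) = ∅ := by ext; simp [condSet]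
    have h2 : margSet ([] : List (Op V)) = ∅ := by ext; simp [margSet]
    rw [h1, h2, reduce_empty hG]
    constructor
    · rintro ⟨⟩
      rfl
    · rintro rfl
      exact .nil _
  | cons o ops ih =>
    rw [List.map_cons, List.nodup_cons] at hnd
    have ho : o.node ∈ G.nodes := hops o (by simp)
    -- One argument for both kinds of operation: exactly one of `S`, `T` is the singleton of the
    -- node operated on, the other is empty.
    have main : ∀ {S T : Set V}, S ⊆ G.nodes → S ∪ T = {o.node} →
        condSet (o :: ops) = S ∪ condSet ops → margSet (o :: ops) = T ∪ margSet ops →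
        (GeneratesList (G.reduce S T) ops H ↔
          H = G.reduce (condSet (o :: ops)) (margSet (o :: ops))) := by
      intro S T hS hST hc hm
      have hops' : ∀ o' ∈ ops, o'.node ∈ (G.reduce S T).nodes := by
        intro o' ho'
        rw [nodes_reduce hG hS, hST]
        refine ⟨hops o' (by simp [ho']), fun h => hnd.1 ?_⟩
        rw [← Set.mem_singleton_iff.1 h]
        exact List.mem_map_of_mem ho'
      rw [ih (isSummaryGraph_reduce hG) hnd.2 hops', hc, hm,
        reduce_reduce hG hS (S' := condSet ops) (T' := margSet ops)
          (fun x hx => hops' (.condition x) hx) (fun x hx => hops' (.marginalise x) hx)]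
    cases o with
    | condition s =>
      have hS : {s} ⊆ G.nodes := Set.singleton_subset_iff.2 ho
      have hgen := fun K => generates_iff (H := K) hG Set.subsingleton_empty hS
        (Set.disjoint_empty _)
      rw [← main hS (T := ∅) (by simp [Op.node]) (by ext; simp [condSet])
        (by ext; simp [margSet])]
      constructor
      · rintro (_ | ⟨h, h'⟩ | _)
        rwa [(hgen _).1 h] at h'
      · exact fun h => .condition ((hgen _).2 rfl) h
    | marginalise t =>
      have hgen := fun K => generates_iff (H := K) hG (Set.subsingleton_singleton (a := t))
        (Set.empty_subset _) (Set.empty_disjoint _)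
      rw [← main (Set.empty_subset _) (T := {t}) (by simp [Op.node]) (by ext; simp [condSet])
        (by ext; simp [margSet])]
      constructor
      · rintro (_ | _ | ⟨h, h'⟩)
        rwa [(hgen _).1 h] at h'
      · exact fun h => .marginalise ((hgen _).2 rfl) h

end MixedGraph

theorem proposition1 {V : Type*} [Finite V] (G : MixedGraph V) (hG : G.IsSummaryGraph) :
    -- the procedure for at most one conditioning node and at most one marginalising node
    (∀ S T : Set V, S.Subsingleton → T.Subsingleton → S ⊆ G.nodes → T ⊆ G.nodes → Disjoint S T →
      ∃ G' : MixedGraph V,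
        G.IsSummaryGraphAfter S T G' ∧
        -- the procedure yields exactly this graph, whatever the order of the ancestors
        (∀ H, G.Generates S T H ↔ H = G') ∧
        -- so does the procedure with the order within its first step reversed
        (∀ H, G.GeneratesCondFirst S T H ↔ H = G') ∧
        -- and so do the two successive single-node procedures, in either order
        (∀ H, (∃ K, G.Generates ∅ T K ∧ K.Generates S ∅ H) ↔ H = G') ∧
        (∀ H, (∃ K, G.Generates S ∅ K ∧ K.Generates ∅ T H) ↔ H = G')) ∧
    -- for larger sets, one node at a time in any order of the operations
    (∀ ops : List (MixedGraph.Op V), (ops.map MixedGraph.Op.node).Nodup →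
      (∀ o ∈ ops, o.node ∈ G.nodes) →
      ∃ G' : MixedGraph V,
        G.IsSummaryGraphAfter (MixedGraph.condSet ops) (MixedGraph.margSet ops) G' ∧
        ∀ ops' : List (MixedGraph.Op V), ops'.Perm ops →
          ∀ H, MixedGraph.GeneratesList G ops' H ↔ H = G') := by
  refine ⟨?_, ?_⟩
  · intro S T hS1 hT1 hS hT hST
    refine ⟨G.reduce S T, MixedGraph.isSummaryGraphAfter_reduce hG hS hT hST,
      fun H => MixedGraph.generates_iff hG hT1 hS hST,
      fun H => MixedGraph.generatesCondFirst_iff hG hT1 hS hST, fun H => ?_, fun H => ?_⟩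
    · have hS' : S ⊆ (G.reduce ∅ T).nodes := by
        rw [MixedGraph.nodes_reduce hG (Set.empty_subset _), Set.empty_union]
        exact Set.subset_sdiff.2 ⟨hS, hST⟩
      simp only [MixedGraph.generates_iff hG hT1 (Set.empty_subset _) (Set.empty_disjoint _),
        exists_eq_left]
      rw [MixedGraph.generates_iff (MixedGraph.isSummaryGraph_reduce hG) Set.subsingleton_empty hS'
        (Set.disjoint_empty _), MixedGraph.reduce_reduce hG (Set.empty_subset _) hS'
        (Set.empty_subset _), Set.empty_union, Set.union_empty]
    · have hT' : T ⊆ (G.reduce S ∅).nodes := by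
        rw [MixedGraph.nodes_reduce hG hS, Set.union_empty]
        exact Set.subset_sdiff.2 ⟨hT, hST.symm⟩
      simp only [MixedGraph.generates_iff hG Set.subsingleton_empty hS (Set.disjoint_empty _),
        exists_eq_left]
      rw [MixedGraph.generates_iff (MixedGraph.isSummaryGraph_reduce hG) hT1 (Set.empty_subset _)
        (Set.empty_disjoint _), MixedGraph.reduce_reduce hG hS (Set.empty_subset _) hT',
        Set.empty_union, Set.union_empty]
  · intro ops hnd hops
    refine ⟨G.reduce (MixedGraph.condSet ops) (MixedGraph.margSet ops),
      MixedGraph.isSummaryGraphAfter_reduce hG (fun x hx => hops (.condition x) hx)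
        (fun x hx => hops (.marginalise x) hx) (MixedGraph.disjoint_condSet_margSet hnd), fun ops' hperm H => ?_⟩
    -- The reduction depends only on the two sets of nodes, which a permutation leaves unchanged.
    have hc : MixedGraph.condSet ops' = MixedGraph.condSet ops := by
      ext; exact hperm.mem_iff
    have hm : MixedGraph.margSet ops' = MixedGraph.margSet ops := by
      ext; exact hperm.mem_iff
    rw [MixedGraph.generatesList_iff hG ((hperm.map _).nodup_iff.2 hnd)
      (fun o ho => hops o (hperm.mem_iff.1 ho)), hc, hm]
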